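/- Let $\mathcal A\subseteq \mathscr B(\mathcal H)$ be a von Neumann algebra on a complex Hilbert space and let $\tau:\mathcal A\to\mathcal A$ be a normal, contractive, completely positive map. For $\lambda\in\mathbb T$ (the unit circle) put $E_\lambda(\tau)=\{x\in\mathcal A:\tau(x)=\lambda x\}$, let $E(\tau)$ be the linear span of $\bigcup_{\lambda\in\mathbb T}E_\lambda(\tau)$, and let $\mathcal P(\tau)$ be the norm closure of $E(\tau)$. Then: (a) The limit $q_\tau:=\operatorname{s-lim}_{n\to\infty}\tau^n(1)$ exists in the strong operator topology. (b) There is exactly one norm-continuous bilinear map $\circ:\mathcal P(\tau)\times\mathcal P(\tau)\to\mathcal P(\tau)$ (the extended Choi–Effros product) such that $$x\circ y=\operatorname{s-lim}_{n\to\infty}\frac{\tau^n(xy)}{\lambda^n\mu^n}\qquad (x\in E_\lambda(\tau),\ y\in E_\mu(\tau),\ \lambda,\mu\in\mathbb T),$$ and $\mathcal P(\tau)$, with this product and with the involution and the norm of $\mathcal A$, is a (possibly zero, not necessarily unital) $C^*$-algebra, the peripheral Poisson boundary of $\tau$. Moreover, if $(\mathcal K,\mathcal B,\theta)$ is a minimal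 dilation of $\tau$, that is, $\mathcal H\subseteq\mathcal K$ are Hilbert spaces with orthogonal projection $p:\mathcal K\to\mathcal H$, $\mathcal B\subseteq\mathscr B(\mathcal K)$ is a von Neumann algebra with $\mathcal A=p\mathcal Bp$, $\theta$ is a normal $*$-endomorphism of $\mathcal B$ with $p\theta^n(z)p=\tau^n(pzp)$ for all $z\in\mathcal B$ and $n\ge 0$, $\mathcal K$ is the closed linear span of the vectors $\theta^n(x_n)\cdots\theta(x_1)h$ ($n\ge0$, $x_i\in\mathcal A$, $h\in\mathcal H$), and $\mathcal B$ is generated as a von Neumann algebra by $\{\theta^n(x):n\ge0,\ x\in\mathcal A\}$, then every $x\in\mathcal P(\tau)$ has a unique lift $\widehat x\in\mathcal P(\theta)$ with $p\widehat xp=x$, and $x\circ y=p\,\widehat x\,\widehat y\,p$ for all $x,y\in\mathcal P(\tau)$. (c) The following are equivalent: (i) $q_\tau\neq0$; (ii) $\tau$ has a nonzero fixed point; (iii) $\mathcal P(\tau)\neq\{0\}$; (iv) $(\mathcal P(\tau),\circ)$ is a unital $C^*$-algebra, with unit different from $0$. (d) If these conditions hold, then $q_\tau$ belongs to $\mathcal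 P(\tau)$ and is the unit of $(\mathcal P(\tau),\circ)$, and $q_\tau$ is the unique maximal Perron–Frobenius eigenvector of $\tau$. Here $x\in\mathcal A$ is a Perron–Frobenius eigenvector of $\tau$ if $x\ge0$, $\|x\|=1$ and $\tau(x)=rx$, where $r$ is the spectral radius of $\tau$; it is maximal if $y\le x$ for every Perron–Frobenius eigenvector $y$ of $\tau$. -/

import Mathlib

open Filter Topology
open scoped CStarAlgebra

/-! ### A (concrete) von Neumann algebra as a C*-algebra ordered by the Loewner order -/

namespace VonNeumannAlgebra

variable {H : Type*} [NormedAddCommGroup H] [InnerProductSpace ℂ H] [CompleteSpace H]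

instance instSMulMemClass : SMulMemClass (VonNeumannAlgebra H) ℂ (H →L[ℂ] H) where
  smul_mem {s} r _ hx := s.toStarSubalgebra.smul_mem hx r

instance instIsClosed (A : VonNeumannAlgebra H) : IsClosed (A : Set (H →L[ℂ] H)) := by
  rw [← A.centralizer_centralizer]
  exact Set.isClosed_centralizer _

noncomputable instance instCStarAlgebra (A : VonNeumannAlgebra H) : CStarAlgebra A :=
  StarSubalgebra.cstarAlgebra A

/-- The order on `A` is the restriction of the Loewner order of `B(H)`; its positive cone is
`{s* s : s ∈ A}`, because a von Neumann algebra contains the square roots of its positive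
elements. -/
instance instStarOrderedRing (A : VonNeumannAlgebra H) : StarOrderedRing A :=
  StarOrderedRing.of_nonneg_iff' (fun {x y} h z => by
      change (z : H →L[ℂ] H) + x ≤ z + y
      have h' : (x : H →L[ℂ] H) ≤ y := h
      gcongr)
    (fun x => by
      constructor
      · intro h
        have h' : (0 : H →L[ℂ] H) ≤ x := h
        have hmem : CFC.sqrt (x : H →L[ℂ] H) ∈ A := by
          have key : CFC.sqrt (x : H →L[ℂ] H) ∈ A.commutant.commutant := by
            rw [mem_commutant_iff]
            intro g hg
            have hc : Commute (x : H →L[ℂ] H) g := (mem_commutant_iff.mp hg) x x.2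
            exact (hc.cfcₙ_nnreal _).eq.symm
          rwa [commutant_commutant] at key
        refine ⟨⟨CFC.sqrt (x : H →L[ℂ] H), hmem⟩, Subtype.ext ?_⟩
        change (x : H →L[ℂ] H) = star (CFC.sqrt (x : H →L[ℂ] H)) * CFC.sqrt (x : H →L[ℂ] H)
        rw [(CFC.sqrt_nonneg (x : H →L[ℂ] H)).isSelfAdjoint.star_eq,
          CFC.sqrt_mul_sqrt_self _ h']
      · rintro ⟨s, rfl⟩
        change (0 : H →L[ℂ] H) ≤ star (s : H →L[ℂ] H) * s
        exact star_mul_self_nonneg _)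

end VonNeumannAlgebra

namespace PeripheralPoisson

variable {H : Type*} [NormedAddCommGroup H] [InnerProductSpace ℂ H] [CompleteSpace H]

/-- Convergence of a sequence in `A ⊆ B(H)` in the strong operator topology of `B(H)`. -/
def SOTTendsto {A : VonNeumannAlgebra H} (a : ℕ → A) (b : A) : Prop :=
  ∀ h : H, Tendsto (fun n => (a n : H →L[ℂ] H) h) atTop (𝓝 ((b : H →L[ℂ] H) h))

/-- The eigenspace `E_λ(T) = {x ∈ A : T x = λ x}`. -/
noncomputable def eigenspace {A : VonNeumannAlgebra H} (T : A →ₗ[ℂ] A) (lam : Circle) : Submodule ℂ A :=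
  Module.End.eigenspace T (lam : ℂ)

/-- `E(T)`: the linear span of all peripheral eigenvectors of `T`. -/
noncomputable def peripheralSpan {A : VonNeumannAlgebra H} (T : A →ₗ[ℂ] A) : Submodule ℂ A :=
  Submodule.span ℂ {x : A | ∃ lam : Circle, x ∈ eigenspace T lam}

/-- `P(T)`: the norm closure of `E(T)`. -/
noncomputable def boundary {A : VonNeumannAlgebra H} (T : A →ₗ[ℂ] A) : Submodule ℂ A :=
  (peripheralSpan T).topologicalClosure

theorem mem_boundary_of_mem_eigenspace {A : VonNeumannAlgebra H} {T : A →ₗ[ℂ] A}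
    {lam : Circle} {x : A} (hx : x ∈ eigenspace T lam) : x ∈ boundary T :=
  (peripheralSpan T).le_topologicalClosure (Submodule.subset_span ⟨lam, hx⟩)

/-- `m` is the extended Choi–Effros product `∘` on `P(τ)`: it is a norm continuous bilinear map
with `x ∘ y = s-lim τⁿ(x y) / (λⁿ μⁿ)` for `x ∈ E_λ(τ)`, `y ∈ E_μ(τ)`, `|λ| = |μ| = 1`.
Since `P(τ)` is the closed linear span of the `E_λ(τ)`, there is at most one such `m`. -/
def IsChoiEffrosProduct {A : VonNeumannAlgebra H} (T : A →ₗ[ℂ] A)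
    (m : boundary T →L[ℂ] boundary T →L[ℂ] boundary T) : Prop :=
  ∀ (lam mu : Circle) (x y : boundary T), (x : A) ∈ eigenspace T lam →
    (y : A) ∈ eigenspace T mu →
    SOTTendsto (fun n => ((lam : ℂ) ^ n * (mu : ℂ) ^ n)⁻¹ • T^[n] ((x : A) * (y : A))) (m x y : A)

/-- The closed subspace `P ⊆ A`, with the norm and the involution of `A` and with the product `m`,
is a C*-algebra (not necessarily unital). -/
structure IsCStarAlgebra {A : VonNeumannAlgebra H} (P : Submodule ℂ A) (m : P →L[ℂ] P →L[ℂ] P) :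
    Prop where
  isClosed : IsClosed (P : Set A)
  star_mem : ∀ x ∈ P, star x ∈ P
  mul_assoc : ∀ x y z : P, m (m x y) z = m x (m y z)
  star_mul : ∀ x y : P, star (m x y : A) = m ⟨star y, star_mem y y.2⟩ ⟨star x, star_mem x x.2⟩
  norm_mul_le : ∀ x y : P, ‖m x y‖ ≤ ‖x‖ * ‖y‖
  norm_star_mul_self : ∀ x : P, ‖m ⟨star x, star_mem x x.2⟩ x‖ = ‖x‖ ^ 2

/-- `e` is a (two-sided) unit for the product `m`. -/
def IsUnitFor {A : VonNeumannAlgebra H} {P : Submodule ℂ A} (m : P →L[ℂ] P →L[ℂ] P) (e : P) :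
    Prop :=
  ∀ x : P, m e x = x ∧ m x e = x

/-- A contractive linear map `T : A → A` as a bounded linear map. -/
noncomputable def contraction {A : VonNeumannAlgebra H} (T : A →ₗ[ℂ] A)
    (hT : ∀ x : A, ‖T x‖ ≤ ‖x‖) : A →L[ℂ] A :=
  T.mkContinuous 1 fun x => by simpa using hT x

/-- `x` is a Perron–Frobenius eigenvector of the bounded map `T`: `x ≥ 0`, `‖x‖ = 1` and
`T x = r x` with `r` the spectral radius of `T`. -/
def IsPerronFrobenius {A : VonNeumannAlgebra H} (T : A →L[ℂ] A) (x : A) : Prop :=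
  0 ≤ x ∧ ‖x‖ = 1 ∧ T x = ((spectralRadius ℂ T).toReal : ℂ) • x

/-- `x` is a maximal Perron–Frobenius eigenvector: the greatest one in the order of `A`. -/
def IsMaximalPerronFrobenius {A : VonNeumannAlgebra H} (T : A →L[ℂ] A) (x : A) : Prop :=
  IsGreatest {y : A | IsPerronFrobenius T y} x

section Dilation

variable {K : Type*} [NormedAddCommGroup K] [InnerProductSpace ℂ K] [CompleteSpace K]

/-- For an isometry `V : H → K` and `x ∈ B(H)`, the operator `V x V*` on `K`, that is, `x` seen as
an operator on `K` which vanishes on the orthogonal complement of (the image of) `H`. -/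
noncomputable def corner (V : H →ₗᵢ[ℂ] K) (x : H →L[ℂ] H) : K →L[ℂ] K :=
  V.toContinuousLinearMap ∘L x ∘L ContinuousLinearMap.adjoint V.toContinuousLinearMap

/-- For an isometry `V : H → K` and `z ∈ B(K)`, the compression `V* z V` of `z` to `H`. -/
noncomputable def compress (V : H →ₗᵢ[ℂ] K) (z : K →L[ℂ] K) : H →L[ℂ] H :=
  ContinuousLinearMap.adjoint V.toContinuousLinearMap ∘L z ∘L V.toContinuousLinearMap

/-- The vector `θⁿ(xₙ) θⁿ⁻¹(xₙ₋₁) ⋯ θ(x₁) h` of `K`, for the list `[xₙ, …, x₁]`. -/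
noncomputable def dilationVector {B : VonNeumannAlgebra K} (θ : B → B) (V : H →ₗᵢ[ℂ] K) :
    List B → H → K
  | [], h => V h
  | x :: l, h => (θ^[l.length + 1] x : K →L[ℂ] K) (dilationVector θ V l h)

/-- `(K, B, θ)`, together with the isometry `V : H → K` which embeds `H` into `K`, is a minimal
dilation of `(H, A, T)`. With `p = V V*` the projection onto `H`:
`A = p B p`, `θ` is a normal *-endomorphism of `B`, `p θⁿ(z) p = Tⁿ(p z p)` for all `z ∈ B`,
`K` is the closed linear span of the vectors `θⁿ(xₙ) ⋯ θ(x₁) h` with `xᵢ ∈ A`, `h ∈ H`, and `B` is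
generated as a von Neumann algebra by the `θⁿ(x)` with `n ≥ 0`, `x ∈ A`. -/
structure MinimalDilation {A : VonNeumannAlgebra H} (T : A →ₗ[ℂ] A) (B : VonNeumannAlgebra K) where
  V : H →ₗᵢ[ℂ] K
  θ : B →⋆ₙₐ[ℂ] B
  normal : ScottContinuous θ
  corner_mem : ∀ x : A, corner V x ∈ B
  compress_mem : ∀ z : B, compress V z ∈ A
  dilates : ∀ (n : ℕ) (z : B), compress V (θ^[n] z) = T^[n] ⟨compress V z, compress_mem z⟩
  minimal : (Submodule.span ℂ {k : K | ∃ (l : List A) (h : H),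
    k = dilationVector θ V (l.map fun x : A => ⟨corner V x, corner_mem x⟩) h}).topologicalClosure = ⊤
  generates : ∀ C : VonNeumannAlgebra K,
    (∀ (n : ℕ) (x : A), (θ^[n] ⟨corner V x, corner_mem x⟩ : K →L[ℂ] K) ∈ C) → B ≤ C

/-- The *-endomorphism of a minimal dilation, as a linear map. -/
noncomputable def MinimalDilation.endo {A : VonNeumannAlgebra H} {T : A →ₗ[ℂ] A} {B : VonNeumannAlgebra K}
    (D : MinimalDilation T B) : B →ₗ[ℂ] B :=
  { toFun := D.θ
    map_add' := map_add D.θ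
    map_smul' := map_smul D.θ }

/-- `x ∘ y = p (x̂ ŷ) p` for a minimal dilation: every `x ∈ P(T)` has exactly one lift `x̂ ∈ P(θ)`,
that is, `p x̂ p = x`, and `m x y` is the compression of `x̂ ŷ` for the lifts `x̂`, `ŷ` of `x`, `y`. -/
def MinimalDilation.IsCompressedProduct {A : VonNeumannAlgebra H} {T : A →ₗ[ℂ] A}
    {B : VonNeumannAlgebra K} (D : MinimalDilation T B)
    (m : boundary T →L[ℂ] boundary T →L[ℂ] boundary T) : Prop :=
  (∀ x : boundary T, ∃! z : B, z ∈ boundary D.endo ∧ compress D.V z = (x : A)) ∧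
  ∀ (x y : boundary T) (z w : B), z ∈ boundary D.endo → w ∈ boundary D.endo →
    compress D.V z = (x : A) → compress D.V w = (y : A) →
    ((m x y : A) : H →L[ℂ] H) = compress D.V (z * w : B)

end Dilation

end PeripheralPoisson

/-!
A combination of eigenvectors of `T` with eigenvalues in the circle has a recurrent orbit, so a
contraction `T` acts on `P(T)` as a surjective isometry. The Kadison–Schwarz inequality makes
`Tⁿ(T⁻ⁿ(x)* T⁻ⁿ(x))` increasing in `n`, hence strongly convergent, and polarization turns this into
the product `x ∘ y = s-lim Tⁿ(T⁻ⁿ(x) T⁻ⁿ(y))` on `P(T)`. As the limit is a supremum,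
`x* ∘ x ≥ x* x`, which gives the C*-identity. Associativity and the unit `q` both rest on one
estimate: if `d n ≥ 0` and `c n`, `d n` are bounded, then `Tⁿ(d n) → 0` strongly implies
`Tⁿ((c n) (d n)) → 0` strongly, again by the Kadison–Schwarz inequality.

For a minimal dilation `θ` with projection `p`, minimality forces `θⁿ(1 - p) → 0` strongly. An
element of `P(θ)` is therefore the strong limit of its corners `θⁿ(p) z θⁿ(p)`, which are
determined by the compression of `z`; so compression is isometric on `P(θ)` and carries the
operator product to `∘`. Conversely the lift of an eigenvector `T x = λ x` is a weak limit point of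
`λ⁻ⁿ θⁿ(x)`, whose corners are consistent.
-/

namespace PeripheralPoisson

section Recurrence

variable {E : Type*}

theorem norm_iterate_le [Norm E] {f : E → E} (hf : ∀ x, ‖f x‖ ≤ ‖x‖) (n : ℕ) (x : E) :
    ‖f^[n] x‖ ≤ ‖x‖ := by
  induction n generalizing x with
  | zero => exact le_rfl
  | succ n ih => exact (ih (f x)).trans (hf x)

theorem pow_apply_of_mem_eigenspace {R M : Type*} [CommRing R] [AddCommGroup M] [Module R M]
    {f : Module.End R M} {c : R} {x : M} (hx : x ∈ f.eigenspace c) (n : ℕ) :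
    (f ^ n) x = c ^ n • x := by
  induction n with
  | zero => simp
  | succ n ih =>
    rw [pow_succ', Module.End.mul_apply, ih, map_smul, Module.End.mem_eigenspace_iff.1 hx,
      smul_smul, pow_succ]

variable [NormedAddCommGroup E] [NormedSpace ℂ E] {f : Module.End ℂ E}

-- The compact group of all functions from the circle to itself carries all eigenvalues at once.
theorem exists_continuous_orbit {x : E}
    (hx : x ∈ Submodule.span ℂ {x : E | ∃ lam : Circle, x ∈ f.eigenspace (lam : ℂ)}) :
    ∃ φ : (Circle → Circle) → E, Continuous φ ∧ φ 1 = x ∧ ∀ n : ℕ, φ (id ^ n) = (f ^ n) x := by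
  induction hx using Submodule.span_induction with
  | mem x hx =>
    obtain ⟨lam, hx⟩ := hx
    refine ⟨fun g => (g lam : ℂ) • x, by fun_prop, by simp, fun n => ?_⟩
    simp [pow_apply_of_mem_eigenspace hx]
  | zero => exact ⟨fun _ => 0, continuous_const, rfl, by simp⟩
  | add x y _ _ hx hy =>
    obtain ⟨φ, hφ, hφ_one, hφ_pow⟩ := hx
    obtain ⟨ψ, hψ, hψ_one, hψ_pow⟩ := hy
    exact ⟨fun g => φ g + ψ g, hφ.add hψ, by simp [hφ_one, hψ_one],
      fun n => by simp [hφ_pow, hψ_pow]⟩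
  | smul c x _ hx =>
    obtain ⟨φ, hφ, hφ_one, hφ_pow⟩ := hx
    exact ⟨fun g => c • φ g, hφ.const_smul c, by simp [hφ_one], fun n => by simp [hφ_pow]⟩

theorem mapClusterPt_pow_apply_of_mem_span {x : E}
    (hx : x ∈ Submodule.span ℂ {x : E | ∃ lam : Circle, x ∈ f.eigenspace (lam : ℂ)}) :
    MapClusterPt x atTop fun n : ℕ => (f ^ n) x := by
  obtain ⟨φ, hφ, hφ_one, hφ_pow⟩ := exists_continuous_orbit hx
  have h := (mapClusterPt_one_atTop_pow (id : Circle → Circle)).continuousAt_comp hφ.continuousAt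
  rw [hφ_one] at h
  exact h.congrFun (.of_forall hφ_pow)

theorem norm_map_of_mem_span (hf : ∀ x, ‖f x‖ ≤ ‖x‖) {x : E}
    (hx : x ∈ Submodule.span ℂ {x : E | ∃ lam : Circle, x ∈ f.eigenspace (lam : ℂ)}) :
    ‖f x‖ = ‖x‖ := by
  refine (hf x).antisymm ?_
  have hclosed : IsClosed {y : E | ‖y‖ ≤ ‖f x‖} := isClosed_le continuous_norm continuous_const
  refine hclosed.mem_of_mapClusterPt (mapClusterPt_pow_apply_of_mem_span hx)
    ((eventually_ge_atTop 1).mono fun n hn => ?_)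
  obtain ⟨k, rfl⟩ := Nat.exists_eq_add_of_le' hn
  rw [pow_succ, Module.End.mul_apply, Module.End.pow_apply]
  exact norm_iterate_le hf k _

end Recurrence

section Boundary

variable {H : Type*} [NormedAddCommGroup H] [InnerProductSpace ℂ H] [CompleteSpace H]
  {A : VonNeumannAlgebra H} {T : A →ₗ[ℂ] A}

theorem mem_eigenspace_iff {lam : Circle} {x : A} :
    x ∈ eigenspace T lam ↔ T x = (lam : ℂ) • x :=
  Module.End.mem_eigenspace_iff

instance instCompleteSpaceBoundary : CompleteSpace (boundary T) :=
  (Submodule.isClosed_topologicalClosure _).completeSpace_coe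

theorem dense_peripheralSpan : Dense {x : boundary T | (x : A) ∈ peripheralSpan T} := fun x => by
  rw [Topology.IsInducing.subtypeVal.closure_eq_preimage_closure_image]
  refine closure_mono (fun y hy => ?_) x.2
  exact ⟨⟨y, (peripheralSpan T).le_topologicalClosure hy⟩, hy, rfl⟩

theorem map_mem_of_eigenvectors {X : Type*} [NormedAddCommGroup X] [NormedSpace ℂ X]
    (f : boundary T →L[ℂ] X) {S : Submodule ℂ X} (hS : IsClosed (S : Set X))
    (h : ∀ (lam : Circle) (x : boundary T), (x : A) ∈ eigenspace T lam → f x ∈ S)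
    (x : boundary T) : f x ∈ S := by
  refine closure_minimal (fun y hy => ?_) (hS.preimage f.continuous) (dense_peripheralSpan x)
  have hle : peripheralSpan T ≤ (S.comap f.toLinearMap).map (boundary T).subtype := by
    refine Submodule.span_le.2 ?_
    rintro x ⟨lam, hx⟩
    exact ⟨⟨x, mem_boundary_of_mem_eigenspace hx⟩, h lam _ hx, rfl⟩
  obtain ⟨z, hz, hzy⟩ := hle hy
  rwa [← Subtype.ext hzy]

theorem eq_of_eigenvectors {X : Type*} [NormedAddCommGroup X] [NormedSpace ℂ X]
    {f g : boundary T →L[ℂ] X}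
    (h : ∀ (lam : Circle) (x : boundary T), (x : A) ∈ eigenspace T lam → f x = g x) : f = g := by
  ext x
  refine sub_eq_zero.1 (map_mem_of_eigenvectors (f - g) (S := ⊥) isClosed_singleton
    (fun lam x hx => ?_) x)
  simp [h lam x hx]

theorem surjective_of_eigenvectors {X : Type*} [NormedAddCommGroup X] [NormedSpace ℂ X]
    [CompleteSpace X] (f : X →ₗᵢ[ℂ] boundary T)
    (h : ∀ (lam : Circle) (x : boundary T), (x : A) ∈ eigenspace T lam → ∃ y, f y = x) :
    Function.Surjective f :=
  map_mem_of_eigenvectors (.id ℂ (boundary T)) (S := LinearMap.range f.toLinearMap)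
    f.isometry.isClosedEmbedding.isClosed_range h

section Contraction

variable (hT : ∀ x : A, ‖T x‖ ≤ ‖x‖)
include hT

theorem norm_map_of_mem_boundary {x : A} (hx : x ∈ boundary T) : ‖T x‖ = ‖x‖ := by
  have hclosed : IsClosed {y : A | ‖T y‖ = ‖y‖} :=
    isClosed_eq (contraction T hT).continuous.norm continuous_norm
  exact closure_minimal (fun y hy => norm_map_of_mem_span hT hy) hclosed hx

theorem map_mem_boundary {x : A} (hx : x ∈ boundary T) : T x ∈ boundary T := by
  refine map_mem_of_eigenvectors ((contraction T hT).comp (boundary T).subtypeL)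
    (peripheralSpan T).isClosed_topologicalClosure (fun lam y hy => ?_) ⟨x, hx⟩
  change T y ∈ boundary T
  rw [mem_eigenspace_iff.1 hy]
  exact (boundary T).smul_mem _ y.2

/-- A contraction `T` as an isometry of its peripheral space `P(T)`. -/
noncomputable def boundaryIsometry : boundary T →ₗᵢ[ℂ] boundary T where
  toLinearMap := T.restrict fun _ hx => map_mem_boundary hT hx
  norm_map' x := norm_map_of_mem_boundary hT x.2

theorem boundaryIsometry_surjective : Function.Surjective (boundaryIsometry hT) := by
  refine surjective_of_eigenvectors _ fun lam x hx => ⟨(lam : ℂ)⁻¹ • x, Subtype.ext ?_⟩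
  change T ((lam : ℂ)⁻¹ • (x : A)) = x
  rw [map_smul, mem_eigenspace_iff.1 hx, inv_smul_smul₀ lam.coe_ne_zero]

/-- The restriction of a contraction `T` to its peripheral space `P(T)`, as an isometric
automorphism. -/
noncomputable def boundaryEquiv : boundary T ≃ₗᵢ[ℂ] boundary T :=
  LinearIsometryEquiv.ofSurjective (boundaryIsometry hT) (boundaryIsometry_surjective hT)

@[simp]
theorem coe_boundaryEquiv (x : boundary T) : (boundaryEquiv hT x : A) = T x := rfl

/-- The map `T⁻ⁿ` on the peripheral space `P(T)` of a contraction `T`. -/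
noncomputable def back (n : ℕ) : boundary T ≃ₗᵢ[ℂ] boundary T :=
  (boundaryEquiv hT)⁻¹ ^ n

theorem boundaryEquiv_back_succ (n : ℕ) (x : boundary T) :
    boundaryEquiv hT (back hT (n + 1) x) = back hT n x := by
  rw [back, pow_succ', LinearIsometryEquiv.coe_mul, Function.comp_apply]
  exact (boundaryEquiv hT).apply_symm_apply _

theorem back_succ_boundaryEquiv (n : ℕ) (x : boundary T) :
    back hT (n + 1) (boundaryEquiv hT x) = back hT n x := by
  rw [back, pow_succ, LinearIsometryEquiv.coe_mul, Function.comp_apply]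
  exact congrArg _ ((boundaryEquiv hT).symm_apply_apply x)

theorem pow_apply_back_add (m n : ℕ) (x : boundary T) :
    (T ^ m) (back hT (m + n) x) = back hT n x := by
  induction m with
  | zero => simp
  | succ m ih =>
    rw [pow_succ, Module.End.mul_apply, Nat.add_right_comm, ← coe_boundaryEquiv hT,
      boundaryEquiv_back_succ, ih]

theorem pow_apply_back (n : ℕ) (x : boundary T) : (T ^ n) (back hT n x) = x :=
  pow_apply_back_add hT n 0 x

theorem coe_back_eq_of_mem_eigenspace {lam : Circle} {x : boundary T}
    (hx : (x : A) ∈ eigenspace T lam) (n : ℕ) :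
    (back hT n x : A) = ((lam : ℂ) ^ n)⁻¹ • (x : A) := by
  induction n with
  | zero => simp [back]
  | succ n ih =>
    have h : back hT (n + 1) ((lam : ℂ) • x) = back hT n x := by
      rw [← show boundaryEquiv hT x = (lam : ℂ) • x from Subtype.ext (mem_eigenspace_iff.1 hx),
        back_succ_boundaryEquiv]
    rw [eq_inv_smul_iff₀ (pow_ne_zero _ lam.coe_ne_zero)] at ih ⊢
    rw [pow_succ, mul_smul, ← Submodule.coe_smul, ← map_smul, h, ih]

end Contraction

end Boundary

theorem star_mul_self_le_norm_smul {B : Type*} [NonUnitalCStarAlgebra B] [PartialOrder B]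
    [StarOrderedRing B] {a : B} (ha : 0 ≤ a) : star a * a ≤ ‖a‖ • a := by
  obtain ⟨s, rfl⟩ := CStarAlgebra.nonneg_iff_eq_star_mul_self.1 ha
  calc star (star s * s) * (star s * s) = star s * (s * star s) * s := by
        simp only [star_mul, star_star, mul_assoc]
    _ ≤ ‖s * star s‖ • (star s * s) := CStarAlgebra.star_left_conjugate_le_norm_smul
    _ = ‖star s * s‖ • (star s * s) := by
        rw [CStarRing.norm_self_mul_star, CStarRing.norm_star_mul_self]

section Operators

open scoped ComplexOrder

variable {H : Type*} [NormedAddCommGroup H] [InnerProductSpace ℂ H] {a b : H →L[ℂ] H}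

theorem reApplyInnerSelf_mono (h : a ≤ b) (x : H) :
    a.reApplyInnerSelf x ≤ b.reApplyInnerSelf x := by
  simpa [ContinuousLinearMap.reApplyInnerSelf, inner_sub_left] using
    ((ContinuousLinearMap.le_def a b).1 h).re_inner_nonneg_left x

theorem operator_le_iff : a ≤ b ↔ ∀ x, inner ℂ (a x) x ≤ inner ℂ (b x) x := by
  rw [ContinuousLinearMap.le_def, ContinuousLinearMap.isPositive_iff_complex]
  refine forall_congr' fun x => ?_
  rw [← sub_nonneg (b := inner ℂ (a x) x), ← inner_sub_left, ← sub_apply,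
    Complex.nonneg_iff, Complex.ext_iff]
  simp [and_comm]

theorem reApplyInnerSelf_smul (r : ℝ) (a : H →L[ℂ] H) (x : H) :
    (r • a).reApplyInnerSelf x = r * a.reApplyInnerSelf x := by
  simp [ContinuousLinearMap.reApplyInnerSelf]

variable [CompleteSpace H]

theorem norm_apply_sq_le_of_nonneg (ha : 0 ≤ a) (x : H) :
    ‖a x‖ ^ 2 ≤ ‖a‖ * a.reApplyInnerSelf x := by
  calc ‖a x‖ ^ 2 = (star a * a).reApplyInnerSelf x := a.apply_norm_sq_eq_inner_adjoint_left x
    _ ≤ (‖a‖ • a).reApplyInnerSelf x := reApplyInnerSelf_mono (star_mul_self_le_norm_smul ha) x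
    _ = ‖a‖ * a.reApplyInnerSelf x := reApplyInnerSelf_smul _ a x

theorem cauchySeq_apply_of_monotone {a : ℕ → H →L[ℂ] H} (ha : Monotone a)
    (hbdd : BddAbove (Set.range a)) (x : H) : CauchySeq fun n => a n x := by
  obtain ⟨b, hb⟩ := hbdd
  have hb (n : ℕ) : a n ≤ b := hb ⟨n, rfl⟩
  set r : ℕ → ℝ := fun n => (a n).reApplyInnerSelf x with hr
  have hr_mono : Monotone r := fun m n hmn => reApplyInnerSelf_mono (ha hmn) x
  have hr_bdd : BddAbove (Set.range r) :=
    ⟨b.reApplyInnerSelf x, Set.forall_mem_range.2 fun n => reApplyInnerSelf_mono (hb n) x⟩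
  have hdiff {n m : ℕ} (hnm : n ≤ m) :
      ‖a m x - a n x‖ ^ 2 ≤ ‖b - a 0‖ * ((⨆ k, r k) - r n) := by
    have hnonneg : 0 ≤ a m - a n := sub_nonneg.2 (ha hnm)
    have hle : a m - a n ≤ b - a 0 := sub_le_sub (hb m) (ha n.zero_le)
    calc ‖a m x - a n x‖ ^ 2 ≤ ‖a m - a n‖ * (a m - a n).reApplyInnerSelf x :=
          norm_apply_sq_le_of_nonneg hnonneg x
      _ = ‖a m - a n‖ * (r m - r n) := by
          simp [hr, ContinuousLinearMap.reApplyInnerSelf, inner_sub_left]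
      _ ≤ ‖b - a 0‖ * ((⨆ k, r k) - r n) := by
          gcongr
          · exact sub_nonneg.2 (hr_mono hnm)
          · exact CStarAlgebra.norm_le_norm_of_nonneg_of_le hnonneg hle
          · exact le_ciSup hr_bdd m
  refine cauchySeq_of_le_tendsto_0' (fun n => √(‖b - a 0‖ * ((⨆ k, r k) - r n)))
    (fun n m hnm => ?_) ?_
  · rw [dist_comm, dist_eq_norm]
    exact Real.le_sqrt_of_sq_le (hdiff hnm)
  · simpa using
      (((tendsto_atTop_ciSup hr_mono hr_bdd).const_sub (⨆ k, r k)).const_mul ‖b - a 0‖).sqrt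

end Operators

section StrongConvergence

open scoped ComplexOrder

variable {H : Type*} [NormedAddCommGroup H] [InnerProductSpace ℂ H] [CompleteSpace H]
  {A : VonNeumannAlgebra H}

theorem mem_of_tendsto_inner {ι : Type*} {l : Filter ι} [l.NeBot] {a : ι → H →L[ℂ] H}
    (ha : ∀ i, a i ∈ A) {b : H →L[ℂ] H}
    (hb : ∀ x y, Tendsto (fun i => inner ℂ (a i x) y) l (𝓝 (inner ℂ (b x) y))) : b ∈ A := by
  rw [← A.commutant_commutant, VonNeumannAlgebra.mem_commutant_iff]
  intro z hz
  refine ContinuousLinearMap.ext fun x => ext_inner_right ℂ fun y => ?_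
  have hcomm (i : ι) : inner ℂ (a i x) (ContinuousLinearMap.adjoint z y) =
      inner ℂ (a i (z x)) y := by
    rw [ContinuousLinearMap.adjoint_inner_right]
    exact congrArg (inner ℂ · y)
      (DFunLike.congr_fun (VonNeumannAlgebra.mem_commutant_iff.1 hz _ (ha i)) x).symm
  have hlim := hb x (ContinuousLinearMap.adjoint z y)
  simp only [hcomm] at hlim
  rw [ContinuousLinearMap.adjoint_inner_right] at hlim
  exact tendsto_nhds_unique hlim (hb (z x) y)

namespace SOTTendsto

variable {a a' : ℕ → A} {b b' : A}

theorem const (b : A) : SOTTendsto (fun _ => b) b := fun _ => tendsto_const_nhds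

theorem add (h : SOTTendsto a b) (h' : SOTTendsto a' b') :
    SOTTendsto (fun n => a n + a' n) (b + b') := fun x => (h x).add (h' x)

theorem sub (h : SOTTendsto a b) (h' : SOTTendsto a' b') :
    SOTTendsto (fun n => a n - a' n) (b - b') := fun x => (h x).sub (h' x)

theorem smul (c : ℂ) (h : SOTTendsto a b) : SOTTendsto (fun n => c • a n) (c • b) := fun x =>
  (h x).const_smul c

theorem comp_succ (h : SOTTendsto a b) : SOTTendsto (fun n => a (n + 1)) b := fun x =>
  (h x).comp (tendsto_add_atTop_nat 1)

theorem unique (h : SOTTendsto a b) (h' : SOTTendsto a b') : b = b' :=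
  Subtype.ext (ContinuousLinearMap.ext fun x => tendsto_nhds_unique (h x) (h' x))

theorem eq_star (h : SOTTendsto a b) (h' : SOTTendsto (fun n => star (a n)) b') :
    b' = star b := by
  refine Subtype.ext (ContinuousLinearMap.ext fun x => ext_inner_right ℂ fun y => ?_)
  change _ = inner ℂ (ContinuousLinearMap.adjoint (b : H →L[ℂ] H) x) y
  rw [ContinuousLinearMap.adjoint_inner_left]
  refine tendsto_nhds_unique ((h' x).inner tendsto_const_nhds)
    ((tendsto_const_nhds.inner (h y)).congr fun n => ?_)
  exact (ContinuousLinearMap.adjoint_inner_left (a n : H →L[ℂ] H) y x).symm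

theorem norm_le (h : SOTTendsto a b) {C : ℝ} (hC : ∀ n, ‖a n‖ ≤ C) : ‖b‖ ≤ C := by
  refine ContinuousLinearMap.opNorm_le_bound _ ((norm_nonneg _).trans (hC 0)) fun x => ?_
  exact le_of_tendsto (h x).norm
    (.of_forall fun n => (a n : H →L[ℂ] H).le_of_opNorm_le (hC n) x)

theorem le (h : SOTTendsto a b) (h' : SOTTendsto a' b') (hle : ∀ᶠ n in atTop, a n ≤ a' n) :
    b ≤ b' := by
  change (b : H →L[ℂ] H) ≤ b'
  rw [operator_le_iff]
  intro x
  exact le_of_tendsto_of_tendsto ((h x).inner tendsto_const_nhds)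
    ((h' x).inner tendsto_const_nhds) (hle.mono fun n hn => operator_le_iff.1 hn x)

theorem isLUB_of_monotone (h : SOTTendsto a b) (ha : Monotone a) : IsLUB (Set.range a) b := by
  refine ⟨Set.forall_mem_range.2 fun n => (const (a n)).le h ?_, fun c hc => ?_⟩
  · exact (eventually_ge_atTop n).mono fun m hm => ha hm
  · exact h.le (const c) (.of_forall fun n => hc ⟨n, rfl⟩)

end SOTTendsto

/-- Vigier's theorem for sequences. -/
theorem exists_sotTendsto_of_monotone {a : ℕ → A} (ha : Monotone a)
    (hbdd : BddAbove (Set.range a)) : ∃ b, SOTTendsto a b := by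
  have hbdd' : BddAbove (Set.range fun n => (a n : H →L[ℂ] H)) := by
    obtain ⟨b, hb⟩ := hbdd
    exact ⟨b, Set.forall_mem_range.2 fun n => hb ⟨n, rfl⟩⟩
  choose f hf using fun x => cauchySeq_tendsto_of_complete
    (cauchySeq_apply_of_monotone (a := fun n => (a n : H →L[ℂ] H)) ha hbdd' x)
  exact ⟨⟨continuousLinearMapOfTendsto (fun n => (a n : H →L[ℂ] H)) (tendsto_pi_nhds.2 hf),
    mem_of_tendsto_inner (l := atTop) (fun n => (a n).2) fun x y =>
      (hf x).inner tendsto_const_nhds⟩, hf⟩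

theorem SOTTendsto.map_of_monotone {K : Type*} [NormedAddCommGroup K] [InnerProductSpace ℂ K]
    [CompleteSpace K] {B : VonNeumannAlgebra K} {f : A → B} (hf : ScottContinuous f) {a : ℕ → A}
    {b : A} (h : SOTTendsto a b) (ha : Monotone a) : SOTTendsto (fun n => f (a n)) (f b) := by
  have hlub : IsLUB (Set.range fun n => f (a n)) (f b) := by
    rw [Set.range_comp' f a]
    exact hf (Set.range_nonempty a) ha.directed_le.directedOn_range (h.isLUB_of_monotone ha)
  have hmono : Monotone fun n => f (a n) := hf.monotone.comp ha
  obtain ⟨c, hc⟩ := exists_sotTendsto_of_monotone hmono ⟨_, hlub.1⟩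
  rwa [← (hc.isLUB_of_monotone hmono).unique hlub]

end StrongConvergence

section SchwarzMaps

variable {B C : Type*} [CStarAlgebra B] [CStarAlgebra C] [PartialOrder C] [StarOrderedRing C]

/-- The Kadison–Schwarz inequality `T(x)* T(x) ≤ T(x* x)`. It holds for contractive completely
positive maps and already makes a linear map of C*-algebras a positive contraction. -/
def IsSchwarz (T : B →ₗ[ℂ] C) : Prop :=
  ∀ x, star (T x) * T x ≤ T (star x * x)

theorem IsSchwarz.norm_map_one_le {T : B →ₗ[ℂ] C} (hT : IsSchwarz T) : ‖T 1‖ ≤ 1 := by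
  have hsq : ‖T 1‖ * ‖T 1‖ ≤ ‖T 1‖ := by
    rw [← CStarRing.norm_star_mul_self]
    simpa using CStarAlgebra.norm_le_norm_of_nonneg_of_le (star_mul_self_nonneg _) (hT 1)
  nlinarith [norm_nonneg (T 1)]

variable [PartialOrder B] [StarOrderedRing B]

namespace IsSchwarz

variable {T : B →ₗ[ℂ] C} (hT : IsSchwarz T)
include hT

theorem map_nonneg {x : B} (hx : 0 ≤ x) : 0 ≤ T x := by
  obtain ⟨s, rfl⟩ := CStarAlgebra.nonneg_iff_eq_star_mul_self.1 hx
  exact (star_mul_self_nonneg _).trans (hT s)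

theorem monotone : Monotone T := fun x y hxy => by
  simpa using hT.map_nonneg (sub_nonneg.2 hxy)

theorem map_star (x : B) : T (star x) = star (T x) :=
  StarHomClass.map_star (PositiveLinearMap.mk₀ T fun _ => hT.map_nonneg) x

theorem map_one_le : T 1 ≤ 1 :=
  (CStarAlgebra.norm_le_one_iff_of_nonneg _ (hT.map_nonneg zero_le_one)).1 hT.norm_map_one_le

theorem norm_map_le (x : B) : ‖T x‖ ≤ ‖x‖ := by
  refine le_of_sq_le_sq ?_ (norm_nonneg x)
  calc ‖T x‖ ^ 2 = ‖star (T x) * T x‖ := by rw [CStarRing.norm_star_mul_self, sq]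
    _ ≤ ‖T (star x * x)‖ :=
      CStarAlgebra.norm_le_norm_of_nonneg_of_le (star_mul_self_nonneg _) (hT x)
    _ ≤ ‖T 1‖ * ‖star x * x‖ :=
      (PositiveLinearMap.mk₀ T fun _ => hT.map_nonneg).norm_apply_le_of_nonneg _
        (star_mul_self_nonneg x)
    _ ≤ ‖x‖ ^ 2 := by
      rw [CStarRing.norm_star_mul_self, ← sq]
      exact mul_le_of_le_one_left (sq_nonneg _) hT.norm_map_one_le

end IsSchwarz

theorem IsSchwarz.pow {T : B →ₗ[ℂ] B} (hT : IsSchwarz T) (n : ℕ) : IsSchwarz (T ^ n) := by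
  induction n with
  | zero => exact fun x => le_rfl
  | succ n ih =>
    intro x
    rw [pow_succ, Module.End.mul_apply, Module.End.mul_apply]
    exact (ih (T x)).trans (ih.monotone (hT x))

theorem sum_star_mul_mul_nonneg {n : Type*} [Fintype n] {M : CStarMatrix n n B} (hM : 0 ≤ M)
    (v : n → B) : 0 ≤ ∑ i, ∑ j, star (v i) * M i j * v j := by
  rw [StarOrderedRing.nonneg_iff] at hM
  induction hM using AddSubmonoid.closure_induction with
  | zero => simp
  | add M N _ _ hM hN => simpa [mul_add, add_mul, Finset.sum_add_distrib] using add_nonneg hM hN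
  | mem M hM =>
    obtain ⟨R, rfl⟩ := hM
    have hsum : ∑ i, ∑ j, star (v i) * (star R * R) i j * v j =
        ∑ k, star (∑ i, R k i * v i) * ∑ j, R k j * v j := by
      simp only [CStarMatrix.mul_apply, CStarMatrix.star_apply, star_sum, star_mul,
        Finset.mul_sum, Finset.sum_mul, mul_assoc]
      rw [Finset.sum_comm_cycle]
      exact Finset.sum_congr rfl fun _ _ => Finset.sum_comm
    rw [hsum]
    exact Finset.sum_nonneg fun k _ => star_mul_self_nonneg _

theorem isSchwarz_of_completelyPositive {τ : B →CP C} (hτ : ‖τ 1‖ ≤ 1) :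
    IsSchwarz τ.toLinearMap := fun x => by
  let S : CStarMatrix (Fin 2) (Fin 2) B := CStarMatrix.ofMatrix !![1, x; 0, 0]
  have hpos : 0 ≤ (star S * S).map τ := τ.map_cstarMatrix_nonneg _ (star_mul_self_nonneg S)
  have hsum := sum_star_mul_mul_nonneg hpos ![-τ x, 1]
  have hentries : (star S * S).map τ = CStarMatrix.ofMatrix
      !![τ 1, τ x; star (τ x), τ (star x * x)] := by
    ext i j
    fin_cases i <;> fin_cases j <;>
      simp [S, CStarMatrix.mul_apply, CStarMatrix.star_apply, map_star]
  rw [hentries] at hsum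
  have hτ_le : τ 1 ≤ 1 :=
    (CStarAlgebra.norm_le_one_iff_of_nonneg _ (map_nonneg τ zero_le_one)).1 hτ
  have hconj : star (τ x) * τ 1 * τ x ≤ star (τ x) * τ x := by
    simpa using star_left_conjugate_le_conjugate hτ_le (τ x)
  refine sub_nonneg.1 ?_
  calc 0 ≤ star (τ x) * τ 1 * τ x + -(star (τ x) * τ x) +
        (-(star (τ x) * τ x) + τ (star x * x)) := by simpa [Fin.sum_univ_two] using hsum
    _ ≤ star (τ x) * τ x + -(star (τ x) * τ x) +
        (-(star (τ x) * τ x) + τ (star x * x)) := by gcongr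
    _ = τ (star x * x) - star (τ x) * τ x := by abel

end SchwarzMaps

section Polarization

variable {E F : Type*} [AddCommGroup E] [Module ℂ E] [AddCommGroup F] [Module ℂ F]

theorem sesquilinear_polarization (φ : E →ₗ⋆[ℂ] E →ₗ[ℂ] F) (x y : E) :
    φ x y = (1 / 4 : ℂ) • (φ (x + y) (x + y) - φ (x - y) (x - y) -
      Complex.I • φ (x + Complex.I • y) (x + Complex.I • y) +
      Complex.I • φ (x - Complex.I • y) (x - Complex.I • y)) := by
  have hI (c : F) : Complex.I • Complex.I • c = -c := by
    rw [smul_smul, Complex.I_mul_I, neg_one_smul]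
  simp only [map_add, map_sub, LinearMap.map_smulₛₗ, LinearMap.add_apply, LinearMap.sub_apply,
    LinearMap.neg_apply, LinearMap.smul_apply, map_smul, Complex.conj_I, smul_add,
    smul_sub, neg_smul, smul_neg, hI]
  module

theorem sesquilinear_ext {φ ψ : E →ₗ⋆[ℂ] E →ₗ[ℂ] F} (h : ∀ x, φ x x = ψ x x) : φ = ψ :=
  LinearMap.ext₂ fun x y => by
    rw [sesquilinear_polarization φ, sesquilinear_polarization ψ]
    simp only [h]

theorem SOTTendsto.of_diag {H : Type*} [NormedAddCommGroup H] [InnerProductSpace ℂ H]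
    [CompleteSpace H] {A : VonNeumannAlgebra H} {φ : ℕ → E →ₗ⋆[ℂ] E →ₗ[ℂ] A} {q : E → A}
    (h : ∀ x, SOTTendsto (fun n => φ n x x) (q x)) (x y : E) :
    SOTTendsto (fun n => φ n x y) ((1 / 4 : ℂ) • (q (x + y) - q (x - y) -
      Complex.I • q (x + Complex.I • y) + Complex.I • q (x - Complex.I • y))) := by
  simp only [fun n => sesquilinear_polarization (φ n) x y]
  exact .smul _ ((((h _).sub (h _)).sub ((h _).smul _)).add ((h _).smul _))

end Polarization

section ChoiEffros

variable {H : Type*} [NormedAddCommGroup H] [InnerProductSpace ℂ H] [CompleteSpace H]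
  {A : VonNeumannAlgebra H} {T : A →ₗ[ℂ] A}

namespace IsSchwarz

variable (hT : IsSchwarz T)
include hT

theorem star_mem_boundary {x : A} (hx : x ∈ boundary T) : star x ∈ boundary T := by
  refine map_mem_of_eigenvectors (boundary T).subtypeL
    (S := (boundary T).comap (starLinearEquiv ℂ : A ≃ₗ⋆[ℂ] A).toLinearMap)
    ((peripheralSpan T).isClosed_topologicalClosure.preimage continuous_star)
    (fun lam y hy => mem_boundary_of_mem_eigenspace (lam := lam⁻¹) ?_) ⟨x, hx⟩
  change star (y : A) ∈ _
  rw [mem_eigenspace_iff, hT.map_star, mem_eigenspace_iff.1 hy, star_smul,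
    Circle.coe_inv_eq_conj]
  rfl

/-- The involution of `A` on the peripheral space `P(T)`. -/
noncomputable def boundaryStar : boundary T →ₗ⋆[ℂ] boundary T where
  toFun x := ⟨star (x : A), hT.star_mem_boundary x.2⟩
  map_add' x y := Subtype.ext (star_add (x : A) y)
  map_smul' c x := Subtype.ext (star_smul c (x : A))

@[simp]
theorem coe_boundaryStar (x : boundary T) : (hT.boundaryStar x : A) = star (x : A) := rfl

@[simp]
theorem boundaryStar_boundaryStar (x : boundary T) : hT.boundaryStar (hT.boundaryStar x) = x :=
  Subtype.ext (star_star (x : A))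

theorem boundaryEquiv_boundaryStar (x : boundary T) :
    boundaryEquiv hT.norm_map_le (hT.boundaryStar x) =
      hT.boundaryStar (boundaryEquiv hT.norm_map_le x) :=
  Subtype.ext (hT.map_star x)

theorem back_boundaryStar (n : ℕ) (x : boundary T) :
    back hT.norm_map_le n (hT.boundaryStar x) = hT.boundaryStar (back hT.norm_map_le n x) := by
  induction n with
  | zero => rfl
  | succ n ih =>
    apply (boundaryEquiv hT.norm_map_le).injective
    rw [boundaryEquiv_back_succ, ih, boundaryEquiv_boundaryStar, boundaryEquiv_back_succ]

/-- The bilinear map `(x, y) ↦ Tⁿ(T⁻ⁿ(x) T⁻ⁿ(y))` on `P(T)`. On eigenvectors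
`x ∈ E_λ(T)`, `y ∈ E_μ(T)` its value is `Tⁿ(x y) / (λⁿ μⁿ)`. -/
noncomputable def approx (n : ℕ) : boundary T →ₗ[ℂ] boundary T →ₗ[ℂ] A :=
  ((LinearMap.mul ℂ A).compl₁₂
    ((boundary T).subtype ∘ₗ (back hT.norm_map_le n).toLinearMap)
    ((boundary T).subtype ∘ₗ (back hT.norm_map_le n).toLinearMap)).compr₂ (T ^ n)

theorem approx_apply (n : ℕ) (x y : boundary T) :
    hT.approx n x y = (T ^ n) (back hT.norm_map_le n x * back hT.norm_map_le n y) := rfl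

theorem approx_boundaryStar_self (n : ℕ) (x : boundary T) : hT.approx n (hT.boundaryStar x) x =
    (T ^ n) (star (back hT.norm_map_le n x : A) * back hT.norm_map_le n x) := by
  rw [approx_apply, back_boundaryStar, coe_boundaryStar]

theorem star_approx (n : ℕ) (x y : boundary T) :
    star (hT.approx n x y) = hT.approx n (hT.boundaryStar y) (hT.boundaryStar x) := by
  simp only [approx_apply, back_boundaryStar, coe_boundaryStar, ← (hT.pow n).map_star, star_mul]

theorem approx_succ_boundaryEquiv (n : ℕ) (x y : boundary T) :
    hT.approx (n + 1) (boundaryEquiv hT.norm_map_le x) (boundaryEquiv hT.norm_map_le y) =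
      T (hT.approx n x y) := by
  simp only [approx_apply, back_succ_boundaryEquiv, pow_succ', Module.End.mul_apply]

theorem norm_approx_le (n : ℕ) (x y : boundary T) : ‖hT.approx n x y‖ ≤ ‖x‖ * ‖y‖ := by
  rw [← (back hT.norm_map_le n).norm_map x, ← (back hT.norm_map_le n).norm_map y]
  exact ((hT.pow n).norm_map_le _).trans (norm_mul_le _ _)

theorem monotone_approx (x : boundary T) :
    Monotone fun n => hT.approx n (hT.boundaryStar x) x := by
  refine monotone_nat_of_le_succ fun n => ?_
  simp only [approx_boundaryStar_self]
  rw [pow_succ, Module.End.mul_apply, ← boundaryEquiv_back_succ]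
  exact (hT.pow n).monotone (hT _)

theorem bddAbove_range_approx (x : boundary T) :
    BddAbove (Set.range fun n => hT.approx n (hT.boundaryStar x) x) := by
  refine ⟨algebraMap ℝ A (‖hT.boundaryStar x‖ * ‖x‖), Set.forall_mem_range.2 fun n => ?_⟩
  have hnonneg : 0 ≤ hT.approx n (hT.boundaryStar x) x := by
    rw [approx_boundaryStar_self]
    exact (hT.pow n).map_nonneg (star_mul_self_nonneg _)
  exact (IsSelfAdjoint.of_nonneg hnonneg).le_algebraMap_norm_self.trans
    (algebraMap_mono A (hT.norm_approx_le n _ _))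

theorem exists_sotTendsto_approx (x y : boundary T) :
    ∃ z : A, SOTTendsto (fun n => hT.approx n x y) z := by
  choose q hq using fun x =>
    exists_sotTendsto_of_monotone (hT.monotone_approx x) (hT.bddAbove_range_approx x)
  have h := SOTTendsto.of_diag (φ := fun n => hT.approx n ∘ₛₗ hT.boundaryStar) hq
    (hT.boundaryStar x) y
  simp only [LinearMap.comp_apply, boundaryStar_boundaryStar] at h
  exact ⟨_, h⟩

/-- The extended Choi–Effros product of `P(T)`, as a bilinear map into `A`: the strong limit of
`Tⁿ(T⁻ⁿ(x) T⁻ⁿ(y))`. -/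
noncomputable def limProd : boundary T →L[ℂ] boundary T →L[ℂ] A :=
  have h (x y : boundary T) := (hT.exists_sotTendsto_approx x y).choose_spec
  LinearMap.mkContinuous₂
    (LinearMap.mk₂ ℂ (fun x y => (hT.exists_sotTendsto_approx x y).choose)
      (fun x x' y => (h _ _).unique (by simpa using (h x y).add (h x' y)))
      (fun c x y => (h _ _).unique (by simpa using (h x y).smul c))
      (fun x y y' => (h _ _).unique (by simpa using (h x y).add (h x y')))
      (fun c x y => (h _ _).unique (by simpa using (h x y).smul c)))
    1 fun x y => by simpa using (h x y).norm_le fun n => hT.norm_approx_le n x y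

theorem sotTendsto_approx (x y : boundary T) :
    SOTTendsto (fun n => hT.approx n x y) (hT.limProd x y) :=
  (hT.exists_sotTendsto_approx x y).choose_spec

section Normal

variable (hN : ScottContinuous T)
include hN

theorem limProd_boundaryEquiv (x y : boundary T) :
    hT.limProd (boundaryEquiv hT.norm_map_le x) (boundaryEquiv hT.norm_map_le y) =
      T (hT.limProd x y) := by
  set U : boundary T →ₗ[ℂ] boundary T := (boundaryEquiv hT.norm_map_le).toLinearMap
  have hdiag (x : boundary T) :
      hT.limProd (U (hT.boundaryStar x)) (U x) = T (hT.limProd (hT.boundaryStar x) x) := by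
    refine SOTTendsto.unique (hT.sotTendsto_approx _ _).comp_succ ?_
    simpa only [U, LinearEquiv.coe_coe, LinearIsometryEquiv.coe_toLinearEquiv,
      approx_succ_boundaryEquiv] using
        (hT.sotTendsto_approx (hT.boundaryStar x) x).map_of_monotone hN (hT.monotone_approx x)
  have hext : hT.limProd.toLinearMap₁₂.compl₁₂ U U ∘ₛₗ hT.boundaryStar =
      hT.limProd.toLinearMap₁₂.compr₂ T ∘ₛₗ hT.boundaryStar :=
    sesquilinear_ext hdiag
  simpa [U] using LinearMap.congr_fun₂ hext (hT.boundaryStar x) y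

theorem limProd_mem_eigenspace {lam mu : Circle} {x y : boundary T}
    (hx : (x : A) ∈ eigenspace T lam) (hy : (y : A) ∈ eigenspace T mu) :
    hT.limProd x y ∈ eigenspace T (lam * mu) := by
  have hx' : boundaryEquiv hT.norm_map_le x = (lam : ℂ) • x :=
    Subtype.ext (mem_eigenspace_iff.1 hx)
  have hy' : boundaryEquiv hT.norm_map_le y = (mu : ℂ) • y :=
    Subtype.ext (mem_eigenspace_iff.1 hy)
  rw [mem_eigenspace_iff, ← hT.limProd_boundaryEquiv hN, hx', hy']
  simp [smul_smul, mul_comm]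

theorem limProd_mem_boundary (x y : boundary T) : hT.limProd x y ∈ boundary T := by
  have hclosed : IsClosed (boundary T : Set A) := (peripheralSpan T).isClosed_topologicalClosure
  refine map_mem_of_eigenvectors (hT.limProd x) (S := boundary T) hclosed (fun mu y hy => ?_) y
  rw [← ContinuousLinearMap.flip_apply]
  refine map_mem_of_eigenvectors (hT.limProd.flip y) (S := boundary T) hclosed
    (fun lam x hx => ?_) x
  rw [ContinuousLinearMap.flip_apply]
  exact mem_boundary_of_mem_eigenspace (hT.limProd_mem_eigenspace hN hx hy)

/-- The extended Choi–Effros product of `P(T)`. -/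
noncomputable def prod : boundary T →L[ℂ] boundary T →L[ℂ] boundary T :=
  LinearMap.mkContinuous₂
    (LinearMap.mk₂ ℂ (fun x y => ⟨hT.limProd x y, hT.limProd_mem_boundary hN x y⟩)
      (fun x x' y => by ext1; simp) (fun c x y => by ext1; simp)
      (fun x y y' => by ext1; simp) (fun c x y => by ext1; simp))
    1 fun x y => by
      simpa using (hT.sotTendsto_approx x y).norm_le fun n => hT.norm_approx_le n x y

theorem sotTendsto_prod (x y : boundary T) :
    SOTTendsto (fun n => hT.approx n x y) (hT.prod hN x y) :=
  hT.sotTendsto_approx x y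

theorem norm_prod_le (x y : boundary T) : ‖hT.prod hN x y‖ ≤ ‖x‖ * ‖y‖ :=
  (hT.sotTendsto_prod hN x y).norm_le fun n => hT.norm_approx_le n x y

theorem boundaryStar_prod (x y : boundary T) : hT.boundaryStar (hT.prod hN x y) =
    hT.prod hN (hT.boundaryStar y) (hT.boundaryStar x) := by
  refine Subtype.ext ((hT.sotTendsto_prod hN x y).eq_star ?_).symm
  simpa only [star_approx] using hT.sotTendsto_prod hN (hT.boundaryStar y) (hT.boundaryStar x)

theorem back_prod (n : ℕ) (x y : boundary T) : back hT.norm_map_le n (hT.prod hN x y) =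
    hT.prod hN (back hT.norm_map_le n x) (back hT.norm_map_le n y) := by
  induction n with
  | zero => rfl
  | succ n ih =>
    apply (boundaryEquiv hT.norm_map_le).injective
    rw [boundaryEquiv_back_succ, ih]
    refine Subtype.ext ?_
    rw [coe_boundaryEquiv]
    refine Eq.trans ?_ (hT.limProd_boundaryEquiv hN _ _)
    rw [boundaryEquiv_back_succ, boundaryEquiv_back_succ]
    rfl

theorem star_mul_self_le_prod (x : boundary T) :
    star (x : A) * x ≤ hT.prod hN (hT.boundaryStar x) x :=
  ((hT.sotTendsto_prod hN _ x).isLUB_of_monotone (hT.monotone_approx x)).1 ⟨0, rfl⟩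

theorem isChoiEffrosProduct_prod : IsChoiEffrosProduct T (hT.prod hN) := by
  intro lam mu x y hx hy
  convert hT.sotTendsto_prod hN x y using 2 with n
  rw [approx_apply, coe_back_eq_of_mem_eigenspace _ hx, coe_back_eq_of_mem_eigenspace _ hy,
    smul_mul_smul_comm, map_smul, Module.End.pow_apply, mul_inv]

end Normal

end IsSchwarz

theorem IsChoiEffrosProduct.unique {m m' : boundary T →L[ℂ] boundary T →L[ℂ] boundary T}
    (hm : IsChoiEffrosProduct T m) (hm' : IsChoiEffrosProduct T m') : m = m' :=
  eq_of_eigenvectors (X := boundary T →L[ℂ] boundary T) fun lam x hx =>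
    eq_of_eigenvectors (X := boundary T) fun mu y hy => Subtype.ext <|
      ((hm lam mu x y hx hy).unique (hm' lam mu x y hx hy))

end ChoiEffros

theorem star_mul_mul_le_smul {B : Type*} [NonUnitalCStarAlgebra B] [PartialOrder B]
    [StarOrderedRing B] {c d : B} (hd : 0 ≤ d) :
    star (c * d) * (c * d) ≤ (‖c‖ ^ 2 * ‖d‖) • d := by
  calc star (c * d) * (c * d) = star d * (star c * c) * d := by simp only [star_mul, mul_assoc]
    _ ≤ ‖star c * c‖ • (star d * d) := CStarAlgebra.star_left_conjugate_le_norm_smul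
    _ ≤ ‖star c * c‖ • ‖d‖ • d := by gcongr; exact star_mul_self_le_norm_smul hd
    _ = (‖c‖ ^ 2 * ‖d‖) • d := by rw [CStarRing.norm_star_mul_self, smul_smul, sq]

section CStarStructure

variable {H : Type*} [NormedAddCommGroup H] [InnerProductSpace ℂ H] [CompleteSpace H]
  {A : VonNeumannAlgebra H}

/-- This replaces the joint strong continuity of multiplication, which is not available because
the maps `S n` are not multiplicative. -/
theorem SOTTendsto.map_mul_of_nonneg {K : Type*} [NormedAddCommGroup K] [InnerProductSpace ℂ K]
    [CompleteSpace K] {B : VonNeumannAlgebra K} {S : ℕ → A →ₗ[ℂ] B} (hS : ∀ n, IsSchwarz (S n))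
    {c d : ℕ → A} {M N : ℝ} (hc : ∀ n, ‖c n‖ ≤ M) (hd : ∀ n, 0 ≤ d n) (hd' : ∀ n, ‖d n‖ ≤ N)
    (h : SOTTendsto (fun n => S n (d n)) 0) : SOTTendsto (fun n => S n (c n * d n)) 0 := by
  intro x
  have : 0 ≤ M := (norm_nonneg _).trans (hc 0)
  set r : ℕ → ℝ := fun n => (S n (d n) : K →L[ℂ] K).reApplyInnerSelf x
  have hr : Tendsto r atTop (𝓝 0) := by
    simpa [r, ContinuousLinearMap.reApplyInnerSelf, Function.comp_def] using
      Complex.continuous_re.continuousAt.tendsto.comp ((h x).inner (tendsto_const_nhds (x := x)))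
  have hbound (n : ℕ) : ‖(S n (c n * d n) : K →L[ℂ] K) x‖ ^ 2 ≤ M ^ 2 * N * r n := by
    have hle : star (S n (c n * d n)) * S n (c n * d n) ≤ (M ^ 2 * N) • S n (d n) := by
      rw [← LinearMap.map_smul_of_tower]
      refine (hS n _).trans ((hS n).monotone ((star_mul_mul_le_smul (hd n)).trans ?_))
      have := hc n
      have := hd' n
      gcongr
      exact hd n
    calc ‖(S n (c n * d n) : K →L[ℂ] K) x‖ ^ 2
        = (star (S n (c n * d n)) * S n (c n * d n) : K →L[ℂ] K).reApplyInnerSelf x :=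
          (S n (c n * d n) : K →L[ℂ] K).apply_norm_sq_eq_inner_adjoint_left x
      _ ≤ ((M ^ 2 * N) • (S n (d n) : K →L[ℂ] K)).reApplyInnerSelf x :=
          reApplyInnerSelf_mono hle x
      _ = M ^ 2 * N * r n := reApplyInnerSelf_smul _ _ x
  have hsq := squeeze_zero (fun n => sq_nonneg _) hbound (by simpa using hr.const_mul (M ^ 2 * N))
  have hnorm := hsq.sqrt
  simp only [Real.sqrt_zero, Real.sqrt_sq (norm_nonneg _)] at hnorm
  exact tendsto_zero_iff_norm_tendsto_zero.2 hnorm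

namespace IsSchwarz

variable {T : A →ₗ[ℂ] A} (hT : IsSchwarz T) (hN : ScottContinuous T)
include hT hN

theorem sotTendsto_pow_mul_prod_sub_self (x y : boundary T) :
    SOTTendsto (fun n => (T ^ n) (back hT.norm_map_le n x *
      (back hT.norm_map_le n (hT.prod hN (hT.boundaryStar y) y) -
        star (back hT.norm_map_le n y : A) * back hT.norm_map_le n y))) 0 := by
  have hle (n : ℕ) : star (back hT.norm_map_le n y : A) * back hT.norm_map_le n y ≤
      back hT.norm_map_le n (hT.prod hN (hT.boundaryStar y) y) := by
    rw [back_prod, back_boundaryStar]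
    exact hT.star_mul_self_le_prod hN _
  refine SOTTendsto.map_mul_of_nonneg (M := ‖x‖) (N := ‖hT.prod hN (hT.boundaryStar y) y‖) hT.pow
    (fun n => ((back hT.norm_map_le n).norm_map x).le) (fun n => sub_nonneg.2 (hle n))
    (fun n => ?_) ?_
  · rw [← (back hT.norm_map_le n).norm_map (hT.prod hN (hT.boundaryStar y) y)]
    exact CStarAlgebra.norm_le_norm_of_nonneg_of_le (sub_nonneg.2 (hle n))
      (sub_le_self _ (star_mul_self_nonneg _))
  · convert (SOTTendsto.const _).sub (hT.sotTendsto_prod hN (hT.boundaryStar y) y) using 2 with n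
    · rw [map_sub, pow_apply_back, approx_boundaryStar_self]
    · rw [sub_self]

theorem sotTendsto_pow_mul_prod_sub (x y z : boundary T) :
    SOTTendsto (fun n => (T ^ n) (back hT.norm_map_le n x *
      (back hT.norm_map_le n (hT.prod hN y z) -
        (back hT.norm_map_le n y : A) * back hT.norm_map_le n z))) 0 := by
  let β (n : ℕ) : boundary T →ₗ[ℂ] A :=
    (boundary T).subtype ∘ₗ (back hT.norm_map_le n).toLinearMap
  let defect (n : ℕ) : boundary T →ₗ[ℂ] boundary T →ₗ[ℂ] A :=
    ((hT.prod hN).toLinearMap₁₂.compr₂ (β n) - (LinearMap.mul ℂ A).compl₁₂ (β n) (β n)).compr₂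
      ((T ^ n) ∘ₗ LinearMap.mulLeft ℂ (β n x))
  have h := SOTTendsto.of_diag (φ := fun n => defect n ∘ₛₗ hT.boundaryStar) (q := 0)
    (fun y => by
      simpa [defect, β, back_boundaryStar] using hT.sotTendsto_pow_mul_prod_sub_self hN x y)
    (hT.boundaryStar y) z
  simpa [defect, β] using h

theorem sotTendsto_pow_mul_mul (x y z : boundary T) :
    SOTTendsto (fun n => (T ^ n) (back hT.norm_map_le n x *
      (back hT.norm_map_le n y * back hT.norm_map_le n z)))
      (hT.prod hN x (hT.prod hN y z)) := by
  simpa [approx_apply, mul_sub] using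
    (hT.sotTendsto_prod hN x (hT.prod hN y z)).sub (hT.sotTendsto_pow_mul_prod_sub hN x y z)

theorem prod_assoc (x y z : boundary T) :
    hT.prod hN (hT.prod hN x y) z = hT.prod hN x (hT.prod hN y z) := by
  have hstar : (hT.prod hN (hT.boundaryStar z) (hT.prod hN (hT.boundaryStar y)
      (hT.boundaryStar x)) : A) = star (hT.prod hN x (hT.prod hN y z) : A) := by
    refine (hT.sotTendsto_pow_mul_mul hN x y z).eq_star ?_
    simpa only [back_boundaryStar, coe_boundaryStar, ← star_mul, (hT.pow _).map_star, mul_assoc]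
      using hT.sotTendsto_pow_mul_mul hN (hT.boundaryStar z) (hT.boundaryStar y)
        (hT.boundaryStar x)
  rw [← boundaryStar_prod, ← boundaryStar_prod] at hstar
  exact Subtype.ext (star_injective hstar)

theorem norm_boundaryStar_prod_self (x : boundary T) :
    ‖hT.prod hN (hT.boundaryStar x) x‖ = ‖x‖ ^ 2 := by
  refine le_antisymm ?_ ?_
  · simpa [sq] using hT.norm_prod_le hN (hT.boundaryStar x) x
  · calc ‖x‖ ^ 2 = ‖star (x : A) * x‖ := by rw [CStarRing.norm_star_mul_self, sq]; rfl
      _ ≤ ‖hT.prod hN (hT.boundaryStar x) x‖ :=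
        CStarAlgebra.norm_le_norm_of_nonneg_of_le (star_mul_self_nonneg _)
          (hT.star_mul_self_le_prod hN x)

theorem isCStarAlgebra_prod : IsCStarAlgebra (boundary T) (hT.prod hN) where
  isClosed := (peripheralSpan T).isClosed_topologicalClosure
  star_mem _ := hT.star_mem_boundary
  mul_assoc := hT.prod_assoc hN
  star_mul x y := congrArg Subtype.val (hT.boundaryStar_prod hN x y)
  norm_mul_le := hT.norm_prod_le hN
  norm_star_mul_self := hT.norm_boundaryStar_prod_self hN

end IsSchwarz

end CStarStructure

theorem spectralRadius_eq_one {E : Type*} [NormedAddCommGroup E] [NormedSpace ℂ E]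
    [CompleteSpace E] {f : E →L[ℂ] E} (hf : ‖f‖ ≤ 1) {x : E} (hfx : f x = x) (hx : x ≠ 0) :
    spectralRadius ℂ f = 1 := by
  have : Nontrivial E := ⟨x, 0, hx⟩
  have hmem : (1 : ℂ) ∈ spectrum ℂ f := by
    rw [ContinuousLinearMap.spectrum_eq]
    refine (Module.End.hasEigenvalue_of_hasEigenvector (x := x) ⟨?_, hx⟩).mem_spectrum
    exact Module.End.mem_eigenspace_iff.2 (hfx.trans (one_smul ℂ x).symm)
  refine le_antisymm ?_ (le_iSup₂_of_le 1 hmem (by simp))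
  exact (spectrum.spectralRadius_le_nnnorm f).trans (by exact_mod_cast hf)

section Unit

variable {H : Type*} [NormedAddCommGroup H] [InnerProductSpace ℂ H] [CompleteSpace H]
  {A : VonNeumannAlgebra H} {T : A →ₗ[ℂ] A}

theorem mem_eigenspace_one {x : A} (hx : T x = x) : x ∈ eigenspace T 1 :=
  mem_eigenspace_iff.2 (by simpa using hx)

theorem contraction_apply (hT : ∀ x : A, ‖T x‖ ≤ ‖x‖) (x : A) : contraction T hT x = T x := rfl

theorem norm_contraction_le (hT : ∀ x : A, ‖T x‖ ≤ ‖x‖) : ‖contraction T hT‖ ≤ 1 :=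
  LinearMap.mkContinuous_norm_le _ zero_le_one _

namespace IsSchwarz

variable (hT : IsSchwarz T)
include hT

theorem monotone_one_sub_pow_one : Monotone fun n => 1 - (T ^ n) 1 := by
  refine monotone_nat_of_le_succ fun n => sub_le_sub_left ?_ 1
  rw [pow_succ, Module.End.mul_apply]
  exact (hT.pow n).monotone hT.map_one_le

theorem exists_sotTendsto_pow_one : ∃ q : A, SOTTendsto (fun n => (T ^ n) 1) q := by
  have hbdd : BddAbove (Set.range fun n => 1 - (T ^ n) 1) :=
    ⟨1, Set.forall_mem_range.2 fun n => sub_le_self _ ((hT.pow n).map_nonneg zero_le_one)⟩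
  obtain ⟨b, hb⟩ := exists_sotTendsto_of_monotone hT.monotone_one_sub_pow_one hbdd
  exact ⟨1 - b, by simpa using (SOTTendsto.const 1).sub hb⟩

section Limit

variable {q : A} (hq : SOTTendsto (fun n => (T ^ n) 1) q)
include hq

theorem limit_nonneg : 0 ≤ q :=
  (SOTTendsto.const 0).le hq (.of_forall fun n => (hT.pow n).map_nonneg zero_le_one)

theorem limit_le_one : q ≤ 1 :=
  hq.le (SOTTendsto.const 1) (.of_forall fun n => (hT.pow n).map_one_le)

theorem le_limit {y : A} (hy : y ≤ 1) (hTy : T y = y) : y ≤ q := by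
  refine (SOTTendsto.const y).le hq (.of_forall fun n => ?_)
  calc y = (T ^ n) y := by rw [Module.End.pow_apply, Function.iterate_fixed hTy]
    _ ≤ (T ^ n) 1 := (hT.pow n).monotone hy

variable (hN : ScottContinuous T)
include hN

theorem map_limit : T q = q := by
  have h := ((SOTTendsto.const 1).sub hq).map_of_monotone hN hT.monotone_one_sub_pow_one
  simp only [map_sub, ← Module.End.mul_apply, ← pow_succ'] at h
  exact sub_right_injective (h.unique ((SOTTendsto.const (T 1)).sub hq.comp_succ))

/-- The strong limit `q` of `Tⁿ(1)`, as an element of `P(T)`. -/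
def boundaryUnit : boundary T :=
  ⟨q, mem_boundary_of_mem_eigenspace (mem_eigenspace_one (hT.map_limit hq hN))⟩

theorem back_boundaryUnit (n : ℕ) :
    back hT.norm_map_le n (hT.boundaryUnit hq hN) = hT.boundaryUnit hq hN := by
  refine Subtype.ext ?_
  rw [coe_back_eq_of_mem_eigenspace _ (mem_eigenspace_one (hT.map_limit hq hN))]
  simp

theorem boundaryStar_boundaryUnit :
    hT.boundaryStar (hT.boundaryUnit hq hN) = hT.boundaryUnit hq hN :=
  Subtype.ext (IsSelfAdjoint.of_nonneg (hT.limit_nonneg hq)).star_eq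

theorem prod_boundaryUnit (x : boundary T) : hT.prod hN x (hT.boundaryUnit hq hN) = x := by
  have hzero : SOTTendsto (fun n => (T ^ n) (back hT.norm_map_le n x * (1 - q))) 0 := by
    refine SOTTendsto.map_mul_of_nonneg (d := fun _ => 1 - q) (M := ‖x‖) (N := ‖1 - q‖) hT.pow
      (fun n => ((back hT.norm_map_le n).norm_map x).le)
      (fun _ => sub_nonneg.2 (hT.limit_le_one hq)) (fun _ => le_rfl) ?_
    simpa [Module.End.pow_apply, Function.iterate_fixed (hT.map_limit hq hN)] using
      hq.sub (SOTTendsto.const q)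
  have happrox (n : ℕ) : (T ^ n) (back hT.norm_map_le n x * (1 - q)) +
      hT.approx n x (hT.boundaryUnit hq hN) = x := by
    rw [approx_apply, back_boundaryUnit, ← map_add, ← mul_add]
    simp only [boundaryUnit, sub_add_cancel, mul_one, pow_apply_back]
  have hsum := hzero.add (hT.sotTendsto_prod hN x (hT.boundaryUnit hq hN))
  simp only [happrox, zero_add] at hsum
  exact Subtype.ext (hsum.unique (SOTTendsto.const (x : A)))

theorem isUnitFor_boundaryUnit : IsUnitFor (hT.prod hN) (hT.boundaryUnit hq hN) := by
  refine fun x => ⟨?_, hT.prod_boundaryUnit hq hN x⟩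
  have h := hT.boundaryStar_prod hN (hT.boundaryStar x) (hT.boundaryUnit hq hN)
  rwa [prod_boundaryUnit, boundaryStar_boundaryStar, boundaryStar_boundaryUnit, eq_comm] at h

theorem norm_limit (hq0 : q ≠ 0) : ‖q‖ = 1 := by
  have h := hT.norm_boundaryStar_prod_self hN (hT.boundaryUnit hq hN)
  rw [boundaryStar_boundaryUnit, prod_boundaryUnit, sq] at h
  exact (mul_eq_left₀ (norm_ne_zero_iff.2 hq0)).1 h.symm

theorem isMaximalPerronFrobenius_limit (hq0 : q ≠ 0) :
    IsMaximalPerronFrobenius (contraction T hT.norm_map_le) q := by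
  have hr : spectralRadius ℂ (contraction T hT.norm_map_le) = 1 :=
    spectralRadius_eq_one (norm_contraction_le hT.norm_map_le) (hT.map_limit hq hN) hq0
  refine ⟨⟨hT.limit_nonneg hq, hT.norm_limit hq hN hq0, ?_⟩, fun y hy => ?_⟩
  · simpa [contraction_apply, hr] using hT.map_limit hq hN
  · obtain ⟨hy_nonneg, hy_norm, hy_map⟩ := hy
    refine hT.le_limit hq ((CStarAlgebra.norm_le_one_iff_of_nonneg y).1 hy_norm.le) ?_
    simpa [contraction_apply, hr] using hy_map

theorem tfae_limit_ne_zero : List.TFAE [q ≠ 0, ∃ x : A, x ≠ 0 ∧ T x = x, boundary T ≠ ⊥,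
    ∃ e : boundary T, e ≠ 0 ∧ IsUnitFor (hT.prod hN) e] := by
  tfae_have 1 → 2 := fun hq0 => ⟨q, hq0, hT.map_limit hq hN⟩
  tfae_have 2 → 3 := fun ⟨x, hx, hTx⟩ hbot => hx <| (Submodule.mem_bot ℂ).1 <|
    hbot ▸ mem_boundary_of_mem_eigenspace (mem_eigenspace_one hTx)
  tfae_have 3 → 1 := by
    rintro hbot rfl
    refine hbot ((Submodule.eq_bot_iff _).2 fun x hx => ?_)
    have hunit : hT.boundaryUnit hq hN = 0 := rfl
    have h := hT.prod_boundaryUnit hq hN ⟨x, hx⟩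
    rw [hunit, map_zero] at h
    exact congrArg Subtype.val h.symm
  tfae_have 1 → 4 := fun hq0 => ⟨hT.boundaryUnit hq hN, fun h => hq0 (congrArg Subtype.val h),
    hT.isUnitFor_boundaryUnit hq hN⟩
  tfae_have 4 → 3 := fun ⟨e, he, _⟩ hbot => he <| Subtype.ext <| (Submodule.mem_bot ℂ).1 <|
    hbot ▸ e.2
  tfae_finish

end Limit

end IsSchwarz

end Unit

section WeakLimits

variable {ι H : Type*} [NormedAddCommGroup H] [InnerProductSpace ℂ H] [CompleteSpace H]

theorem exists_tendsto_inner_ultrafilter (U : Ultrafilter ι) {a : ι → H →L[ℂ] H} {C : ℝ}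
    (ha : ∀ i, ‖a i‖ ≤ C) : ∃ b : H →L[ℂ] H,
      ∀ x y, Tendsto (fun i => inner ℂ (a i x) y) U (𝓝 (inner ℂ (b x) y)) := by
  have hbound (x y : H) (i : ι) : ‖inner ℂ (a i x) y‖ ≤ C * ‖x‖ * ‖y‖ := by
    refine (norm_inner_le_norm _ _).trans ?_
    gcongr
    exact (a i).le_of_opNorm_le (ha i) x
  have hex (x y : H) : ∃ c : ℂ, Tendsto (fun i => inner ℂ (a i x) y) U (𝓝 c) := by
    obtain ⟨c, -, hc⟩ := (isCompact_closedBall (0 : ℂ) (C * ‖x‖ * ‖y‖)).ultrafilter_le_nhds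
      (U.map fun i => inner ℂ (a i x) y)
      (tendsto_principal.2 (.of_forall fun i => mem_closedBall_zero_iff.2 (hbound x y i)))
    exact ⟨c, hc⟩
  choose g hg using hex
  let G : H →L⋆[ℂ] H →L[ℂ] ℂ := LinearMap.mkContinuous₂
    (LinearMap.mk₂'ₛₗ (starRingEnd ℂ) (RingHom.id ℂ) g
      (fun x x' y => tendsto_nhds_unique (hg _ _)
        (by simpa only [map_add, inner_add_left] using (hg x y).add (hg x' y)))
      (fun c x y => tendsto_nhds_unique (hg _ _)
        (by simpa only [map_smul, inner_smul_left, smul_eq_mul] using (hg x y).const_mul _))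
      (fun x y y' => tendsto_nhds_unique (hg _ _)
        (by simpa only [inner_add_right] using (hg x y).add (hg x y')))
      (fun c x y => tendsto_nhds_unique (hg _ _)
        (by simpa only [inner_smul_right, smul_eq_mul, RingHom.id_apply] using
          (hg x y).const_mul _)))
    C fun x y => le_of_tendsto (hg x y).norm (.of_forall (hbound x y))
  refine ⟨InnerProductSpace.continuousLinearMapOfBilin G, fun x y => ?_⟩
  rw [InnerProductSpace.continuousLinearMapOfBilin_apply]
  exact hg x y

theorem mul_mul_eq_of_tendsto_inner {l : Filter ι} [l.NeBot] {a : ι → H →L[ℂ] H}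
    {b c d e : H →L[ℂ] H}
    (hb : ∀ x y, Tendsto (fun i => inner ℂ (a i x) y) l (𝓝 (inner ℂ (b x) y)))
    (h : ∀ᶠ i in l, c * a i * d = e) : c * b * d = e := by
  refine ContinuousLinearMap.ext fun x => ext_inner_right ℂ fun y => ?_
  have hlim := hb (d x) (ContinuousLinearMap.adjoint c y)
  simp only [ContinuousLinearMap.adjoint_inner_right] at hlim
  exact tendsto_nhds_unique hlim (tendsto_const_nhds.congr' (h.mono fun i hi => by rw [← hi]; rfl))

theorem SOTTendsto.mul {A : VonNeumannAlgebra H} {a a' : ℕ → A} {b b' : A} {C : ℝ}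
    (ha : ∀ n, ‖a n‖ ≤ C) (h : SOTTendsto a b) (h' : SOTTendsto a' b') :
    SOTTendsto (fun n => a n * a' n) (b * b') := by
  intro x
  have hsmall : Tendsto (fun n => (a n : H →L[ℂ] H) ((a' n : H →L[ℂ] H) x - (b' : H →L[ℂ] H) x))
      atTop (𝓝 0) := by
    refine squeeze_zero_norm (fun n => (a n : H →L[ℂ] H).le_of_opNorm_le (ha n) _) ?_
    simpa using (tendsto_iff_norm_sub_tendsto_zero.1 (h' x)).const_mul C
  simpa using hsmall.add (h ((b' : H →L[ℂ] H) x))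

theorem SOTTendsto.of_dense_span {A : VonNeumannAlgebra H} {a : ℕ → A} {b : A} {C : ℝ}
    (ha : ∀ n, ‖a n‖ ≤ C) {S : Set H} (hS : (Submodule.span ℂ S).topologicalClosure = ⊤)
    (h : ∀ x ∈ S, Tendsto (fun n => (a n : H →L[ℂ] H) x) atTop (𝓝 ((b : H →L[ℂ] H) x))) :
    SOTTendsto a b := by
  have hequi : Equicontinuous fun n => ⇑(a n : H →L[ℂ] H) :=
    ((NormedSpace.equicontinuous_TFAE fun n => (a n : H →L[ℂ] H)).out 5 1 :).1 ⟨C, ha⟩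
  have hspan {x : H} (hx : x ∈ Submodule.span ℂ S) :
      Tendsto (fun n => (a n : H →L[ℂ] H) x) atTop (𝓝 ((b : H →L[ℂ] H) x)) := by
    induction hx using Submodule.span_induction with
    | mem x hx => exact h x hx
    | zero => simp
    | add x y _ _ hx hy => simpa using hx.add hy
    | smul c x _ hx => simpa using hx.const_smul c
  intro x
  exact closure_minimal (fun y => hspan)
    (hequi.isClosed_setOfPred_tendsto (b : H →L[ℂ] H).continuous)
    (Submodule.dense_iff_topologicalClosure_eq_top.2 hS x)

end WeakLimits

section Dilation

variable {H : Type*} [NormedAddCommGroup H] [InnerProductSpace ℂ H] [CompleteSpace H]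
  {K : Type*} [NormedAddCommGroup K] [InnerProductSpace ℂ K] [CompleteSpace K]

section Compress

variable (V : H →ₗᵢ[ℂ] K)

theorem adjoint_apply_self (x : H) :
    ContinuousLinearMap.adjoint V.toContinuousLinearMap (V x) = x :=
  DFunLike.congr_fun (V.toContinuousLinearMap.norm_map_iff_adjoint_comp_self.1 V.norm_map) x

theorem norm_compress_le (z : K →L[ℂ] K) : ‖compress V z‖ ≤ ‖z‖ := by
  have hV : ‖V.toContinuousLinearMap‖ ≤ 1 := V.norm_toContinuousLinearMap_le
  have hV' : ‖ContinuousLinearMap.adjoint V.toContinuousLinearMap‖ ≤ 1 := by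
    rwa [LinearIsometryEquiv.norm_map]
  calc ‖compress V z‖ ≤ ‖ContinuousLinearMap.adjoint V.toContinuousLinearMap‖ *
          (‖z‖ * ‖V.toContinuousLinearMap‖) :=
        (ContinuousLinearMap.opNorm_comp_le _ _).trans
          (by gcongr; exact ContinuousLinearMap.opNorm_comp_le _ _)
    _ ≤ 1 * (‖z‖ * 1) := by gcongr
    _ = ‖z‖ := by rw [one_mul, mul_one]

end Compress

namespace MinimalDilation

variable {A : VonNeumannAlgebra H} {T : A →ₗ[ℂ] A} {B : VonNeumannAlgebra K}
  (D : MinimalDilation T B)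

theorem coe_θ_pow (n : ℕ) : ⇑(D.θ ^ n) = D.θ^[n] :=
  hom_coe_pow _ rfl (fun _ _ => rfl) _ _

theorem endo_pow_apply (n : ℕ) (z : B) : (D.endo ^ n) z = (D.θ ^ n) z := by
  rw [coe_θ_pow, Module.End.pow_apply]
  rfl

theorem θ_add_apply (m n : ℕ) (z : B) : (D.θ ^ (m + n)) z = (D.θ ^ m) ((D.θ ^ n) z) := by
  rw [pow_add]
  rfl

theorem isSchwarz_endo : IsSchwarz D.endo := fun z =>
  (congrArg (· * D.θ z) (map_star D.θ z).symm).trans (map_mul D.θ _ _).symm |>.le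

/-- The map `x ↦ V x V*` from `A` to `B`, by which `A` is regarded as a corner of `B`. -/
noncomputable def embed : A →⋆ₙₐ[ℂ] B where
  toFun x := ⟨corner D.V x, D.corner_mem x⟩
  map_smul' c x := by ext; simp [corner]
  map_zero' := by ext; simp [corner]
  map_add' x y := by ext; simp [corner]
  map_mul' x y := by ext; simp [corner, adjoint_apply_self]
  map_star' x := by
    ext1
    simp [corner, ContinuousLinearMap.star_eq_adjoint, ContinuousLinearMap.adjoint_comp,
      ContinuousLinearMap.comp_assoc]

/-- The compression `z ↦ V* z V` from `B` to `A`. -/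
noncomputable def compression : B →L[ℂ] A :=
  LinearMap.mkContinuous
    { toFun := fun z => ⟨compress D.V z, D.compress_mem z⟩
      map_add' := fun z w => by ext; simp [compress]
      map_smul' := fun c z => by ext; simp [compress] }
    1 fun z => by simpa using norm_compress_le D.V z

theorem coe_compression (z : B) : (D.compression z : H →L[ℂ] H) = compress D.V z := rfl

theorem norm_compression_le (z : B) : ‖D.compression z‖ ≤ ‖z‖ :=
  norm_compress_le D.V z

theorem compression_one : D.compression 1 = 1 := by
  ext; simp [coe_compression, compress, adjoint_apply_self]

theorem compression_embed (x : A) : D.compression (D.embed x) = x := by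
  ext; simp [coe_compression, compress, corner, embed, adjoint_apply_self]

theorem embed_mul_mul_embed (x y : A) (z : B) :
    D.embed x * z * D.embed y = D.embed (x * D.compression z * y) := rfl

theorem compression_mul_embed_one_mul (z w : B) :
    D.compression (z * D.embed 1 * w) = D.compression z * D.compression w := rfl

theorem compression_pow_apply (n : ℕ) (z : B) :
    D.compression ((D.θ ^ n) z) = (T ^ n) (D.compression z) := by
  rw [coe_θ_pow, Module.End.pow_apply]
  exact Subtype.ext (D.dilates n z)

theorem sotTendsto_compression {z : ℕ → B} {w : B} (h : SOTTendsto z w) :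
    SOTTendsto (fun n => D.compression (z n)) (D.compression w) := fun x =>
  ((ContinuousLinearMap.adjoint D.V.toContinuousLinearMap).continuous.tendsto _).comp (h (D.V x))

theorem apply_eq_zero_of_compression_star_mul_self {z : B} (hz : D.compression (star z * z) = 0)
    (x : H) : (z : K →L[ℂ] K) (D.V x) = 0 := by
  have hinner : inner ℂ ((star z * z : K →L[ℂ] K) (D.V x)) (D.V x) = 0 :=
    (ContinuousLinearMap.adjoint_inner_left D.V.toContinuousLinearMap x _).symm.trans
      ((congrArg (fun a : A => inner ℂ ((a : H →L[ℂ] H) x) x) hz).trans (inner_zero_left x))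
  have hsq : ‖(z : K →L[ℂ] K) (D.V x)‖ ^ 2 = 0 :=
    ((z : K →L[ℂ] K).apply_norm_sq_eq_inner_adjoint_left (D.V x)).trans (congrArg _ hinner)
  simpa using hsq

theorem mul_embed_eq_zero {z : B} (hz : D.compression (star z * z) = 0) (x : A) :
    z * D.embed x = 0 := by
  ext k
  exact D.apply_eq_zero_of_compression_star_mul_self hz _

/-- The projection `θⁿ(p)`, where `p = V V*`. -/
noncomputable def proj (n : ℕ) : B := (D.θ ^ n) (D.embed 1)

/-- The projection `θⁿ(1 - p)`, where `p = V V*`. As `θ` need not be unital, this is in general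
smaller than `1 - θⁿ(p)`, and unlike the latter it tends to `0`. -/
noncomputable def remainder (n : ℕ) : B := (D.θ ^ n) (1 - D.embed 1)

theorem isStarProjection_remainder (n : ℕ) : IsStarProjection (D.remainder n) :=
  (((IsStarProjection.one A).map D.embed).one_sub).map (D.θ ^ n)

theorem compression_remainder (n : ℕ) : D.compression (D.remainder n) = 0 := by
  rw [remainder, compression_pow_apply, map_sub, compression_one, compression_embed, sub_self,
    map_zero]

theorem compression_star_remainder_mul_self (n : ℕ) :
    D.compression (star (D.remainder n) * D.remainder n) = 0 := by
  have h := D.isStarProjection_remainder n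
  rw [h.isSelfAdjoint.star_eq, h.isIdempotentElem.eq, compression_remainder]

theorem remainder_mul_pow_embed {m n : ℕ} (hmn : m ≤ n) (x : A) :
    D.remainder n * (D.θ ^ m) (D.embed x) = 0 := by
  obtain ⟨k, rfl⟩ := Nat.exists_eq_add_of_le hmn
  rw [remainder, θ_add_apply, ← map_mul]
  exact (congrArg _ (D.mul_embed_eq_zero (D.compression_star_remainder_mul_self k) x)).trans
    (map_zero _)

theorem remainder_apply_dilationVector {n : ℕ} {l : List A} (hl : l.length ≤ n) (h : H) :
    (D.remainder n : K →L[ℂ] K) (dilationVector D.θ D.V (l.map D.embed) h) = 0 := by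
  match l with
  | [] =>
    exact D.apply_eq_zero_of_compression_star_mul_self (D.compression_star_remainder_mul_self n) h
  | x :: l =>
    have hmul := D.remainder_mul_pow_embed hl x
    rw [coe_θ_pow, List.length_cons, ← l.length_map D.embed] at hmul
    exact congrArg (fun z : B => (z : K →L[ℂ] K) (dilationVector D.θ D.V (l.map D.embed) h)) hmul

theorem norm_remainder_le (n : ℕ) : ‖D.remainder n‖ ≤ 1 :=
  (D.isStarProjection_remainder n).norm_le

theorem sotTendsto_remainder : SOTTendsto D.remainder 0 := by
  refine SOTTendsto.of_dense_span D.norm_remainder_le D.minimal ?_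
  rintro _ ⟨l, h, rfl⟩
  exact tendsto_const_nhds.congr' ((eventually_ge_atTop l.length).mono fun n hn =>
    (D.remainder_apply_dilationVector hn h).symm)

/-- `z` lives on every range projection `θⁿ(1)`, as all elements of `P(θ)` do. On such elements
`θⁿ(p)` acts as `1 - θⁿ(1 - p)`, which tends strongly to `1`. -/
def IsTailSupported (z : B) : Prop :=
  ∀ n, (D.θ ^ n) 1 * z = z ∧ z * (D.θ ^ n) 1 = z

namespace IsTailSupported

variable {D} {z w : B} (hz : D.IsTailSupported z)
include hz

theorem proj_mul (n : ℕ) : D.proj n * z = (1 - D.remainder n) * z := by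
  rw [remainder, map_sub, sub_mul, sub_mul, (hz n).1, one_mul, sub_sub_cancel, proj]

theorem mul_proj (n : ℕ) : z * D.proj n = z * (1 - D.remainder n) := by
  rw [remainder, map_sub, mul_sub, mul_sub, (hz n).2, mul_one, sub_sub_cancel, proj]

theorem sotTendsto_mul_proj_mul (w : B) : SOTTendsto (fun n => z * D.proj n * w) (z * w) := by
  have hlim := (SOTTendsto.const (z * w)).sub ((SOTTendsto.const z).mul (fun _ => le_rfl)
    (D.sotTendsto_remainder.mul D.norm_remainder_le (.const w)))
  simpa [hz.mul_proj, mul_sub, sub_mul, mul_assoc] using hlim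

theorem sotTendsto_proj_mul_mul_proj : SOTTendsto (fun n => D.proj n * z * D.proj n) z := by
  have hone : SOTTendsto (fun n => 1 - D.remainder n) 1 := by
    simpa using (SOTTendsto.const (1 : B)).sub D.sotTendsto_remainder
  have hnorm (n : ℕ) : ‖1 - D.remainder n‖ ≤ 1 :=
    (D.isStarProjection_remainder n).one_sub.norm_le
  have hlim := hone.mul hnorm ((SOTTendsto.const z).mul (fun _ => le_rfl) hone)
  simpa only [hz.proj_mul, mul_assoc, hz.mul_proj, one_mul, mul_one] using hlim

theorem θ_apply : D.IsTailSupported (D.θ z) := by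
  rintro (_ | n)
  · exact ⟨one_mul _, mul_one _⟩
  · rw [Nat.add_comm, θ_add_apply]
    change D.θ _ * D.θ z = D.θ z ∧ D.θ z * D.θ _ = D.θ z
    rw [← map_mul, ← map_mul, (hz n).1, (hz n).2]
    exact ⟨rfl, rfl⟩

theorem smul (c : ℂ) : D.IsTailSupported (c • z) := fun n => by
  rw [mul_smul_comm, smul_mul_assoc, (hz n).1, (hz n).2]
  exact ⟨rfl, rfl⟩

theorem ext (hw : D.IsTailSupported w)
    (h : ∀ n, D.proj (n + 1) * z * D.proj (n + 1) = D.proj (n + 1) * w * D.proj (n + 1)) :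
    z = w := by
  have hlim := hz.sotTendsto_proj_mul_mul_proj.comp_succ
  simp only [h] at hlim
  exact hlim.unique hw.sotTendsto_proj_mul_mul_proj.comp_succ

end IsTailSupported

theorem proj_mul_pow_mul_proj (n : ℕ) (z : B) :
    D.proj n * (D.θ ^ n) z * D.proj n = (D.θ ^ n) (D.embed (D.compression z)) := by
  rw [proj, ← map_mul, ← map_mul, embed_mul_mul_embed, one_mul, mul_one]

theorem proj_succ_mul_θ_mul_proj_succ (n : ℕ) (z : B) :
    D.proj (n + 1) * D.θ z * D.proj (n + 1) = D.θ (D.proj n * z * D.proj n) := by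
  have hproj : D.proj (n + 1) = D.θ (D.proj n) := by
    rw [proj, Nat.add_comm, θ_add_apply, pow_one, proj]
  rw [hproj, map_mul, map_mul]

theorem exists_isTailSupported_of_bounded {z : ℕ → B} {C : ℝ} (hz : ∀ n, ‖z n‖ ≤ C)
    (hleft : ∀ n k, (D.θ ^ n) 1 * z (n + k) = z (n + k))
    (hright : ∀ n k, z (n + k) * (D.θ ^ n) 1 = z (n + k))
    (hproj : ∀ n k, D.proj n * z (n + k) * D.proj n = z n) :
    ∃ w : B, D.IsTailSupported w ∧ ∀ n, D.proj n * w * D.proj n = z n := by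
  obtain ⟨w, hw⟩ :=
    exists_tendsto_inner_ultrafilter (hyperfilter ℕ) (a := fun n => (z n : K →L[ℂ] K)) hz
  have hmem : w ∈ B := mem_of_tendsto_inner (l := hyperfilter ℕ) (fun n => (z n).2) hw
  have hlim {c d e : B} (n : ℕ) (h : ∀ k, c * z (n + k) * d = e) : c * ⟨w, hmem⟩ * d = e := by
    refine Subtype.ext (mul_mul_eq_of_tendsto_inner hw (Nat.hyperfilter_le_atTop ?_))
    filter_upwards [eventually_ge_atTop n] with m hm
    obtain ⟨k, rfl⟩ := Nat.exists_eq_add_of_le hm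
    exact congrArg Subtype.val (h k)
  refine ⟨⟨w, hmem⟩, fun n => ⟨?_, ?_⟩, fun n => hlim n (hproj n)⟩
  · have h := hlim (c := 1 - (D.θ ^ n) 1) (d := 1) (e := 0) n fun k => by
      rw [mul_one, sub_mul, one_mul, hleft, sub_self]
    rwa [mul_one, sub_mul, one_mul, sub_eq_zero, eq_comm] at h
  · have h := hlim (c := 1) (d := 1 - (D.θ ^ n) 1) (e := 0) n fun k => by
      rw [one_mul, mul_sub, mul_one, hright, sub_self]
    rwa [one_mul, mul_sub, mul_one, sub_eq_zero, eq_comm] at h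

theorem exists_mem_eigenspace_compression_eq {lam : Circle} {x : A} (hx : x ∈ eigenspace T lam) :
    ∃ w ∈ eigenspace D.endo lam, D.compression w = x := by
  set z : ℕ → B := fun n => ((lam : ℂ) ^ n)⁻¹ • (D.θ ^ n) (D.embed x) with hz
  have hlam : (lam : ℂ) ≠ 0 := lam.coe_ne_zero
  have hθz (n : ℕ) : D.θ (z n) = (lam : ℂ) • z (n + 1) := by
    simp only [hz]
    rw [map_smul, pow_succ (lam : ℂ), mul_inv_rev, smul_smul, mul_inv_cancel_left₀ hlam,
      Nat.add_comm n 1, θ_add_apply, pow_one]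
  obtain ⟨w, hw, hproj⟩ := D.exists_isTailSupported_of_bounded (z := z) (C := ‖x‖)
    (fun n => by
      simp only [hz]
      rw [norm_smul, norm_inv, norm_pow, Circle.norm_coe, one_pow, inv_one, one_mul]
      exact (NonUnitalStarAlgHom.norm_apply_le _ _).trans (NonUnitalStarAlgHom.norm_apply_le _ _))
    (fun n k => by simp only [hz, mul_smul_comm, θ_add_apply, ← map_mul, one_mul])
    (fun n k => by simp only [hz, smul_mul_assoc, θ_add_apply, ← map_mul, mul_one])
    (fun n k => by
      simp only [hz, mul_smul_comm, smul_mul_assoc]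
      rw [θ_add_apply, proj_mul_pow_mul_proj, compression_pow_apply, compression_embed,
        pow_apply_of_mem_eigenspace hx, map_smul, map_smul, smul_smul, pow_add]
      congr 1
      field_simp)
  refine ⟨w, mem_eigenspace_iff.2 (hw.θ_apply.ext (hw.smul _) fun n => ?_), ?_⟩
  · rw [mul_smul_comm, smul_mul_assoc, proj_succ_mul_θ_mul_proj_succ, hproj, hproj, hθz]
  · have h : D.embed (D.compression w) = D.embed x := by
      refine (D.proj_mul_pow_mul_proj 0 w).symm.trans ((hproj 0).trans ?_)
      simp [hz]
    rw [← D.compression_embed (D.compression w), h, compression_embed]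

include D in
theorem norm_map_le (x : A) : ‖T x‖ ≤ ‖x‖ := by
  have hx : T x = D.compression (D.θ (D.embed x)) := by
    simpa [compression_embed] using (D.compression_pow_apply 1 (D.embed x)).symm
  rw [hx]
  exact (D.norm_compression_le _).trans
    ((NonUnitalStarAlgHom.norm_apply_le _ _).trans (NonUnitalStarAlgHom.norm_apply_le _ _))

theorem pow_back (n : ℕ) (z : boundary D.endo) :
    (D.θ ^ n) (back D.isSchwarz_endo.norm_map_le n z : B) = z := by
  rw [← endo_pow_apply, pow_apply_back]

theorem isTailSupported_of_mem_boundary (z : boundary D.endo) : D.IsTailSupported z := fun n => by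
  rw [← D.pow_back n z, ← map_mul, ← map_mul, one_mul, mul_one]
  exact ⟨rfl, rfl⟩

theorem compression_endo (z : B) : D.compression (D.endo z) = T (D.compression z) := by
  rw [← pow_one D.endo, endo_pow_apply, compression_pow_apply, pow_one]

theorem compression_mem_boundary (z : boundary D.endo) : D.compression z ∈ boundary T := by
  refine map_mem_of_eigenvectors (D.compression.comp (boundary D.endo).subtypeL)
    (S := boundary T) (peripheralSpan T).isClosed_topologicalClosure
    (fun lam w hw => mem_boundary_of_mem_eigenspace (lam := lam) ?_) z
  change D.compression w ∈ _
  rw [mem_eigenspace_iff, ← compression_endo, mem_eigenspace_iff.1 hw, map_smul]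

/-- The compression of `P(θ)` to `P(T)`. -/
noncomputable def boundaryCompression : boundary D.endo →ₗ[ℂ] boundary T :=
  D.compression.toLinearMap.restrict fun z hz => D.compression_mem_boundary ⟨z, hz⟩

theorem coe_boundaryCompression (z : boundary D.endo) :
    (D.boundaryCompression z : A) = D.compression z := rfl

theorem back_boundaryCompression (n : ℕ) (z : boundary D.endo) :
    back D.norm_map_le n (D.boundaryCompression z) =
      D.boundaryCompression (back D.isSchwarz_endo.norm_map_le n z) := by
  induction n with
  | zero => rfl
  | succ n ih =>
    apply (boundaryEquiv D.norm_map_le).injective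
    rw [boundaryEquiv_back_succ, ih, ← boundaryEquiv_back_succ]
    exact Subtype.ext (D.compression_endo _)

theorem norm_boundaryCompression (z : boundary D.endo) : ‖D.boundaryCompression z‖ = ‖z‖ := by
  refine (D.norm_compression_le z).antisymm
    ((D.isTailSupported_of_mem_boundary z).sotTendsto_proj_mul_mul_proj.norm_le fun n => ?_)
  have h : D.proj n * z * D.proj n =
      (D.θ ^ n) (D.embed (back D.norm_map_le n (D.boundaryCompression z))) := by
    rw [back_boundaryCompression, coe_boundaryCompression, ← proj_mul_pow_mul_proj, pow_back]
  rw [h]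
  refine (NonUnitalStarAlgHom.norm_apply_le _ _).trans
    ((NonUnitalStarAlgHom.norm_apply_le _ _).trans_eq ?_)
  exact (back D.norm_map_le n).norm_map _

theorem boundaryCompression_bijective : Function.Bijective D.boundaryCompression := by
  let f : boundary D.endo →ₗᵢ[ℂ] boundary T := ⟨D.boundaryCompression, D.norm_boundaryCompression⟩
  refine ⟨f.injective, surjective_of_eigenvectors f fun lam x hx => ?_⟩
  obtain ⟨w, hw, hwx⟩ := D.exists_mem_eigenspace_compression_eq hx
  exact ⟨⟨w, mem_boundary_of_mem_eigenspace hw⟩, Subtype.ext hwx⟩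

variable (hT : IsSchwarz T) (hN : ScottContinuous T)

theorem compression_mul (z w : boundary D.endo) :
    D.compression (z * w) = hT.prod hN (D.boundaryCompression z) (D.boundaryCompression w) := by
  have happrox (n : ℕ) : D.compression (z * D.proj n * w) =
      hT.approx n (D.boundaryCompression z) (D.boundaryCompression w) := by
    rw [IsSchwarz.approx_apply, back_boundaryCompression, back_boundaryCompression,
      coe_boundaryCompression, coe_boundaryCompression, ← compression_mul_embed_one_mul,
      ← compression_pow_apply, map_mul (D.θ ^ n), map_mul (D.θ ^ n), pow_back, pow_back, proj]
  have hlim := D.sotTendsto_compression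
    ((D.isTailSupported_of_mem_boundary z).sotTendsto_mul_proj_mul w)
  simp only [happrox] at hlim
  exact hlim.unique (hT.sotTendsto_prod hN _ _)

theorem isCompressedProduct_prod : D.IsCompressedProduct (hT.prod hN) := by
  refine ⟨fun x => ?_, fun x y z w hz hw hzx hwy => ?_⟩
  · obtain ⟨z, rfl⟩ := D.boundaryCompression_bijective.surjective x
    refine ⟨z, ⟨z.2, rfl⟩, fun w hw => ?_⟩
    exact congrArg Subtype.val (D.boundaryCompression_bijective.injective
      (a₁ := ⟨w, hw.1⟩) (Subtype.ext (Subtype.ext hw.2)))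
  · obtain rfl : D.boundaryCompression ⟨z, hz⟩ = x := Subtype.ext (Subtype.ext hzx)
    obtain rfl : D.boundaryCompression ⟨w, hw⟩ = y := Subtype.ext (Subtype.ext hwy)
    exact congrArg Subtype.val (D.compression_mul hT hN ⟨z, hz⟩ ⟨w, hw⟩).symm

end MinimalDilation

end Dilation

end PeripheralPoisson

open PeripheralPoisson in
theorem mainTheorem1_general {H : Type*} [NormedAddCommGroup H] [InnerProductSpace ℂ H]
    [CompleteSpace H] (A : VonNeumannAlgebra H) (T : A →ₗ[ℂ] A) (hT : IsSchwarz T)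
    (hN : ScottContinuous T) :
    ∃ (q : A) (m : boundary T →L[ℂ] boundary T →L[ℂ] boundary T),
      SOTTendsto (fun n => T^[n] 1) q ∧
      IsChoiEffrosProduct T m ∧
      (∀ m', IsChoiEffrosProduct T m' → m' = m) ∧
      (∀ (K : Type*) [NormedAddCommGroup K] [InnerProductSpace ℂ K] [CompleteSpace K]
        (B : VonNeumannAlgebra K) (D : MinimalDilation T B), D.IsCompressedProduct m) ∧
      IsCStarAlgebra (boundary T) m ∧
      List.TFAE [
        q ≠ 0,
        ∃ x : A, x ≠ 0 ∧ T x = x,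
        boundary T ≠ ⊥,
        ∃ e : boundary T, e ≠ 0 ∧ IsUnitFor m e] ∧
      (q ≠ 0 →
        (∃ hq : q ∈ boundary T, IsUnitFor m ⟨q, hq⟩) ∧
        IsMaximalPerronFrobenius (contraction T hT.norm_map_le) q ∧
        ∀ x : A, IsMaximalPerronFrobenius (contraction T hT.norm_map_le) x → x = q) := by
  obtain ⟨q, hq⟩ := hT.exists_sotTendsto_pow_one
  have hproduct := hT.isChoiEffrosProduct_prod hN
  refine ⟨q, hT.prod hN, by simpa only [Module.End.pow_apply] using hq, hproduct,
    fun m' hm' => hm'.unique hproduct, fun K _ _ _ B D => D.isCompressedProduct_prod hT hN,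
    hT.isCStarAlgebra_prod hN, hT.tfae_limit_ne_zero hq hN, fun hq0 => ?_⟩
  have hmax := hT.isMaximalPerronFrobenius_limit hq hN hq0
  exact ⟨⟨(hT.boundaryUnit hq hN).2, hT.isUnitFor_boundaryUnit hq hN⟩, hmax,
    fun x hx => hx.unique hmax⟩

theorem mainTheorem1 {H : Type*} [NormedAddCommGroup H] [InnerProductSpace ℂ H]
    [CompleteSpace H] (A : VonNeumannAlgebra H) (τ : A →CP A)
    (hcontractive : ∀ x : A, ‖τ x‖ ≤ ‖x‖) (hnormal : ScottContinuous τ) :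
    ∃ (q : A) (m : PeripheralPoisson.boundary τ.toLinearMap →L[ℂ]
        PeripheralPoisson.boundary τ.toLinearMap →L[ℂ]
        PeripheralPoisson.boundary τ.toLinearMap),
      -- `q` is the strong limit of `τⁿ(1)`
      PeripheralPoisson.SOTTendsto (fun n => τ^[n] 1) q ∧
      -- `m` is the extended Choi–Effros product, and it makes `P(τ)` a C*-algebra
      PeripheralPoisson.IsChoiEffrosProduct τ.toLinearMap m ∧
      (∀ m', PeripheralPoisson.IsChoiEffrosProduct τ.toLinearMap m' → m' = m) ∧
      (∀ (K : Type*) [NormedAddCommGroup K] [InnerProductSpace ℂ K] [CompleteSpace K]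
        (B : VonNeumannAlgebra K) (D : PeripheralPoisson.MinimalDilation τ.toLinearMap B),
        D.IsCompressedProduct m) ∧
      PeripheralPoisson.IsCStarAlgebra (PeripheralPoisson.boundary τ.toLinearMap) m ∧
      -- the four equivalent conditions
      List.TFAE [
        q ≠ 0,
        ∃ x : A, x ≠ 0 ∧ τ x = x,
        PeripheralPoisson.boundary τ.toLinearMap ≠ ⊥,
        ∃ e : PeripheralPoisson.boundary τ.toLinearMap,
          e ≠ 0 ∧ PeripheralPoisson.IsUnitFor m e] ∧
      -- the description of `q` when these conditions hold
      (q ≠ 0 →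
        (∃ hq : q ∈ PeripheralPoisson.boundary τ.toLinearMap,
          PeripheralPoisson.IsUnitFor m ⟨q, hq⟩) ∧
        PeripheralPoisson.IsMaximalPerronFrobenius (PeripheralPoisson.contraction τ.toLinearMap hcontractive) q ∧
        ∀ x : A, PeripheralPoisson.IsMaximalPerronFrobenius (PeripheralPoisson.contraction τ.toLinearMap hcontractive) x → x = q) := by
  exact mainTheorem1_general A τ.toLinearMap (PeripheralPoisson.isSchwarz_of_completelyPositive
    ((hcontractive 1).trans ContinuousLinearMap.norm_id_le)) hnormal
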